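/- Let $d\ge 1$, $H\in(0,1)$, $\kappa>0$, and let $\{W(t,x);\,t\in\mathbb{R}\}_{x\in\mathbb{Z}^d}$ be a family of independent fractional Brownian motions of Hurst parameter $H$ on a probability space with expectation $\mathbb{E}$, that is, centred Gaussian processes with continuous sample paths and covariance $\mathbb{E}[W(t,x)W(s,x)]=R_H(t,s):=\frac12\bigl(|t|^{2H}+|s|^{2H}-|t-s|^{2H}\bigr)$. Let $\mathcal{H}$ be the Hilbert space obtained by completing the linear span of the indicator functions $\mathbf 1_{[0,t]\times\{x\}}$, $t\in\mathbb{R}$, $x\in\mathbb{Z}^d$ (where $\mathbf 1_{[0,t]\times\{x\}}:=-\mathbf 1_{[t,0]\times\{x\}}$ for $t<0$), under the scalar product $\langle \mathbf 1_{[0,t]\times\{x\}},\mathbf 1_{[0,s]\times\{y\}}\rangle_{\mathcal H}=R_H(t,s)\,\delta_x(y)$, and let $\mathbf W:\mathcal H\to L^2$ be the linear isometry with $\mathbf W(\mathbf 1_{[0,t]\times\{x\}})=W(t,x)$. For smooth random variables $F=f(\mathbf W(\varphi_1),\dots,\mathbf W(\varphi_n))$, with $\varphi_i\in\mathcal H$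 and $f\in C^\infty(\mathbb{R}^n)$ of polynomial growth together with all its derivatives, let $\nabla F=\sum_i\partial_i f(\mathbf W(\varphi_1),\dots,\mathbf W(\varphi_n))\,\varphi_i$; the space $\mathbb{D}^{1,2}$ is the closure of these $F$ under the norm $\bigl(\mathbb{E}|F|^2+\mathbb{E}\|\nabla F\|_{\mathcal H}^2\bigr)^{1/2}$, and $\nabla$ denotes also the closure of the derivative operator, defined on $\mathbb{D}^{1,2}$. Let $X$ be the continuous-time simple random walk on $\mathbb{Z}^d$ with jump rate $\kappa$, started at $x$ and independent of $W$, and let $\mathbb{E}^x$ be the expectation with respect to $X$ only. Let $u_o:\mathbb{Z}^d\to\mathbb{R}$ be bounded, and for $t\ge0$ and $\varepsilon>0$ put $$u(t,x)=\mathbb{E}^x\Bigl[u_o(X(t))\exp\int_0^t W(\mathrm{d}s,X(t-s))\Bigr],\qquad u_\varepsilon(t,x)=\mathbb{E}^x\Bigl[u_o(X(t))\exp\int_0^t \dot W_\varepsilon(s,X(t-s))\,\mathrm{d}s\Bigr],$$ where $\dot W_\varepsilon(s,y)=\frac1{2\varepsilon}\bigl(W(s+\varepsilon,y)-W(s-\varepsilon,y)\bigr)$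 and $\int_0^t W(\mathrm{d}s,X(t-s))=\sum_{i=0}^{n}\bigl(W(t_{i+1},x_i)-W(t_i,x_i)\bigr)$, with $0=t_0<t_1<\dots<t_n<t_{n+1}=t$, where $t_1,\dots,t_n$ are the jump times of $s\mapsto X(t-s)$ in $(0,t)$ and $x_i$ is its value on $(t_i,t_{i+1})$. Then for every $T>0$ and $x\in\mathbb{Z}^d$: for every $s\in[0,T]$ and $\varepsilon>0$ the expectations $\mathbb{E}^x$ that define $u(s,x)$ and $u_\varepsilon(s,x)$ exist almost surely as absolutely convergent integrals, $u(s,x)$ and $u_\varepsilon(s,x)$ belong to $\mathbb{D}^{1,2}$, and $\tilde u_\varepsilon:=u_\varepsilon-u$ satisfies $$\sup_{s\in[0,T]}\mathbb{E}\bigl(|\tilde u_\varepsilon(s,x)|^2+\|\nabla\tilde u_\varepsilon(s,x)\|_{\mathcal H}^2\bigr)\longrightarrow 0\qquad\text{as }\varepsilon\downarrow0 .$$ -/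

import Mathlib

open MeasureTheory ProbabilityTheory Filter Topology Set
open scoped ENNReal BigOperators

noncomputable section

namespace FractionalPAM

/-- The Hurst parameters `H ∈ (0,1)`. -/
abbrev HurstIndex : Type := Set.Ioo (0 : ℝ) 1

/-- The lattice `ℤ^d`. -/
abbrev Site (d : ℕ) : Type := Fin d → ℤ

/-- The covariance function `R_H(t,s) = (|t|^{2H} + |s|^{2H} - |t-s|^{2H}) / 2`. -/
def fbmCov (H t s : ℝ) : ℝ :=
  (|t| ^ (2 * H) + |s| ^ (2 * H) - |t - s| ^ (2 * H)) / 2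

/-! ### Positive semidefiniteness of the covariance function

This is what makes the scalar product on step functions below a (semi-)inner product.  It follows
from `|u|^{2H} ∫_0^∞ (1 - cos ξ) ξ^{-1-2H} dξ = ∫_0^∞ (1 - cos (u ξ)) ξ^{-1-2H} dξ`. -/

lemma integrableOn_one_sub_cos (H : HurstIndex) (u : ℝ) :
    IntegrableOn (fun ξ : ℝ => (1 - Real.cos (u * ξ)) * ξ ^ (-1 - 2 * (H : ℝ))) (Ioi 0) := by
  obtain ⟨H, h0, h1⟩ := H
  have hm : ∀ s : Set ℝ, AEStronglyMeasurable
      (fun ξ : ℝ => (1 - Real.cos (u * ξ)) * ξ ^ (-1 - 2 * H)) (volume.restrict s) := by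
    intro s
    exact (by fun_prop : Measurable
      (fun ξ : ℝ => (1 - Real.cos (u * ξ)) * ξ ^ (-1 - 2 * H))).aestronglyMeasurable
  rw [← Ioc_union_Ioi_eq_Ioi (zero_le_one' ℝ)]
  refine IntegrableOn.union ?_ ?_
  · have hi : IntegrableOn (fun ξ : ℝ => (u ^ 2 / 2) * ξ ^ (1 - 2 * H)) (Ioc 0 1) := by
      have := (intervalIntegral.intervalIntegrable_rpow' (a := 0) (b := 1)
        (r := 1 - 2 * H) (by linarith)).const_mul (u ^ 2 / 2)
      exact (intervalIntegrable_iff_integrableOn_Ioc_of_le zero_le_one).1 this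
    refine hi.mono' (hm _) ?_
    filter_upwards [ae_restrict_mem measurableSet_Ioc] with ξ hξ
    have hp : 0 < ξ ^ (-1 - 2 * H) := Real.rpow_pos_of_pos hξ.1 _
    have hc : 0 ≤ 1 - Real.cos (u * ξ) := by linarith [Real.cos_le_one (u * ξ)]
    have hq : 1 - Real.cos (u * ξ) ≤ (u * ξ) ^ 2 / 2 := by
      linarith [Real.one_sub_sq_div_two_le_cos (x := u * ξ)]
    rw [Real.norm_of_nonneg (mul_nonneg hc hp.le)]
    have he : ξ ^ (1 - 2 * H) = ξ ^ 2 * ξ ^ (-1 - 2 * H) := by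
      rw [← Real.rpow_natCast ξ 2, ← Real.rpow_add hξ.1]
      congr 1
      push_cast
      ring
    rw [he]
    calc _ ≤ (u * ξ) ^ 2 / 2 * ξ ^ (-1 - 2 * H) := by gcongr
      _ = _ := by ring
  · have hi : IntegrableOn (fun ξ : ℝ => 2 * ξ ^ (-1 - 2 * H)) (Ioi 1) :=
      (integrableOn_Ioi_rpow_of_lt (by linarith) zero_lt_one).const_mul 2
    refine hi.mono' (hm _) ?_
    filter_upwards [ae_restrict_mem measurableSet_Ioi] with ξ hξ
    have hξ0 : (0 : ℝ) < ξ := lt_trans zero_lt_one hξ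
    have hp : 0 < ξ ^ (-1 - 2 * H) := Real.rpow_pos_of_pos hξ0 _
    have hc : 0 ≤ 1 - Real.cos (u * ξ) := by linarith [Real.cos_le_one (u * ξ)]
    rw [Real.norm_of_nonneg (mul_nonneg hc hp.le)]
    have := Real.neg_one_le_cos (u * ξ)
    gcongr
    linarith

lemma integral_one_sub_cos_pos (H : HurstIndex) :
    0 < ∫ ξ in Ioi (0 : ℝ), (1 - Real.cos (1 * ξ)) * ξ ^ (-1 - 2 * (H : ℝ)) := by
  have hnn : ∀ ξ ∈ Ioi (0 : ℝ), 0 ≤ (1 - Real.cos (1 * ξ)) * ξ ^ (-1 - 2 * (H : ℝ)) :=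
    fun ξ hξ => mul_nonneg (by linarith [Real.cos_le_one (1 * ξ)]) (Real.rpow_nonneg (le_of_lt hξ) _)
  rw [setIntegral_pos_iff_support_of_nonneg_ae
    ((ae_restrict_mem measurableSet_Ioi).mono hnn) (integrableOn_one_sub_cos H 1)]
  refine lt_of_lt_of_le (b := volume (Ioo (0 : ℝ) 1)) (by simp) (measure_mono ?_)
  intro ξ hξ
  refine ⟨?_, hξ.1⟩
  have h1 : Real.cos ξ < 1 := by
    rw [← Real.cos_zero]
    exact Real.cos_lt_cos_of_nonneg_of_le_pi le_rfl (by linarith [hξ.2, Real.pi_gt_three]) hξ.1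
  have : 0 < (1 - Real.cos (1 * ξ)) * ξ ^ (-1 - 2 * (H : ℝ)) :=
    mul_pos (by rw [one_mul]; linarith) (Real.rpow_pos_of_pos hξ.1 _)
  exact this.ne'

lemma integral_one_sub_cos (H : HurstIndex) (u : ℝ) :
    ∫ ξ in Ioi (0 : ℝ), (1 - Real.cos (u * ξ)) * ξ ^ (-1 - 2 * (H : ℝ)) =
      |u| ^ (2 * (H : ℝ)) *
        ∫ ξ in Ioi (0 : ℝ), (1 - Real.cos (1 * ξ)) * ξ ^ (-1 - 2 * (H : ℝ)) := by
  have hH := H.2.1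
  rcases eq_or_ne u 0 with rfl | hu
  · simp [Real.zero_rpow (by linarith : (2 * (H : ℝ)) ≠ 0)]
  have hu' : 0 < |u| := abs_pos.2 hu
  have key := integral_comp_mul_left_Ioi
    (fun ξ : ℝ => (1 - Real.cos (1 * ξ)) * ξ ^ (-1 - 2 * (H : ℝ))) 0 hu'
  simp only [mul_zero, smul_eq_mul] at key
  have e : ∫ ξ in Ioi (0 : ℝ), (1 - Real.cos (1 * (|u| * ξ))) * (|u| * ξ) ^ (-1 - 2 * (H : ℝ)) =
      |u| ^ (-1 - 2 * (H : ℝ)) *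
        ∫ ξ in Ioi (0 : ℝ), (1 - Real.cos (u * ξ)) * ξ ^ (-1 - 2 * (H : ℝ)) := by
    rw [← integral_const_mul]
    refine setIntegral_congr_fun measurableSet_Ioi fun ξ hξ => ?_
    have hc : Real.cos (1 * (|u| * ξ)) = Real.cos (u * ξ) := by
      rw [one_mul, ← Real.cos_abs (u * ξ), abs_mul, abs_of_pos (show (0 : ℝ) < ξ from hξ)]
    simp only [hc, Real.mul_rpow hu'.le (le_of_lt hξ)]
    ring
  rw [e] at key
  have hp : |u| ^ (-1 - 2 * (H : ℝ)) = |u|⁻¹ * (|u| ^ (2 * (H : ℝ)))⁻¹ := by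
    rw [sub_eq_add_neg, Real.rpow_add hu', Real.rpow_neg_one, Real.rpow_neg hu'.le]
  have h2 : 0 < |u| ^ (2 * (H : ℝ)) := Real.rpow_pos_of_pos hu' _
  rw [hp] at key
  field_simp at key
  simpa only [one_mul] using key

/-- The bilinear form `⟨1_{[0,t]×{x}}, 1_{[0,s]×{y}}⟩ = R_H(t,s) δ_x(y)` on generators. -/
def genInner {d : ℕ} (H : HurstIndex) (p q : ℝ × Site d) : ℝ :=
  if p.2 = q.2 then fbmCov H p.1 q.1 else 0

lemma genInner_symm {d : ℕ} (H : HurstIndex) (p q : ℝ × Site d) :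
    genInner H p q = genInner H q p := by
  unfold genInner fbmCov
  by_cases h : p.2 = q.2
  · rw [if_pos h, if_pos h.symm, abs_sub_comm q.1 p.1]
    ring
  · rw [if_neg h, if_neg fun h' => h h'.symm]

lemma sum_ite_mul_nonneg {d : ℕ} (S : Finset (ℝ × Site d)) (f : ℝ × Site d → ℝ) :
    0 ≤ ∑ p ∈ S, ∑ q ∈ S, if p.2 = q.2 then f p * f q else 0 := by
  have : ∑ p ∈ S, ∑ q ∈ S, (if p.2 = q.2 then f p * f q else 0) =
      ∑ x ∈ S.image Prod.snd, (∑ p ∈ S, if p.2 = x then f p else 0) ^ 2 := by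
    simp_rw [sq, Finset.sum_mul_sum]
    rw [Finset.sum_comm]
    simp_rw [Finset.sum_comm (s := S.image Prod.snd)]
    rw [Finset.sum_comm]
    refine Finset.sum_congr rfl fun p hp => Finset.sum_congr rfl fun q _ => ?_
    rw [Finset.sum_eq_single p.2]
    · by_cases h : p.2 = q.2
      · simp [h]
      · have h' : ¬ q.2 = p.2 := fun h' => h h'.symm
        simp [h, h']
    · intro x _ hx
      simp [hx.symm]
    · intro h
      exact absurd (Finset.mem_image_of_mem _ hp) h
  rw [this]
  exact Finset.sum_nonneg fun _ _ => sq_nonneg _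

/-- The bilinear extension of `genInner` to formal finite linear combinations. -/
def formInner {d : ℕ} (H : HurstIndex) (a b : (ℝ × Site d) →₀ ℝ) : ℝ :=
  a.sum fun p α => b.sum fun q β => α * β * genInner H p q

lemma formInner_comm {d : ℕ} (H : HurstIndex) (a b : (ℝ × Site d) →₀ ℝ) :
    formInner H a b = formInner H b a := by
  unfold formInner
  rw [Finsupp.sum_comm]
  simp only [Finsupp.sum]
  refine Finset.sum_congr rfl fun p _ => Finset.sum_congr rfl fun q _ => ?_
  rw [genInner_symm]
  ring

lemma formInner_add_left {d : ℕ} (H : HurstIndex) (a b c : (ℝ × Site d) →₀ ℝ) :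
    formInner H (a + b) c = formInner H a c + formInner H b c := by
  refine Finsupp.sum_add_index' (fun p => ?_) (fun p α β => ?_)
  · simp [Finsupp.sum]
  · simp only [Finsupp.sum, ← Finset.sum_add_distrib]
    exact Finset.sum_congr rfl fun q _ => by ring

lemma formInner_smul_left {d : ℕ} (H : HurstIndex) (a b : (ℝ × Site d) →₀ ℝ) (r : ℝ) :
    formInner H (r • a) b = r * formInner H a b := by
  refine (Finsupp.sum_smul_index' (fun p => ?_)).trans ?_
  · simp [Finsupp.sum]
  · simp only [formInner, Finsupp.sum, Finset.mul_sum, smul_eq_mul]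
    exact Finset.sum_congr rfl fun p _ => Finset.sum_congr rfl fun q _ => by ring

lemma formInner_self_nonneg {d : ℕ} (H : HurstIndex) (a : (ℝ × Site d) →₀ ℝ) :
    0 ≤ formInner H a a := by
  unfold formInner
  set I := ∫ ξ in Ioi (0 : ℝ), (1 - Real.cos (1 * ξ)) * ξ ^ (-1 - 2 * (H : ℝ)) with hI
  have hIpos : 0 < I := integral_one_sub_cos_pos H
  set k : ℝ × Site d → ℝ × Site d → ℝ → ℝ := fun p q ξ =>
    if p.2 = q.2 then
      ((1 - Real.cos (p.1 * ξ)) * ξ ^ (-1 - 2 * (H : ℝ))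
        + (1 - Real.cos (q.1 * ξ)) * ξ ^ (-1 - 2 * (H : ℝ))
        - (1 - Real.cos ((p.1 - q.1) * ξ)) * ξ ^ (-1 - 2 * (H : ℝ))) else 0 with hk
  have hki : ∀ p q, IntegrableOn (k p q) (Ioi 0) := by
    intro p q
    by_cases h : p.2 = q.2
    · simp only [hk, if_pos h]
      exact ((integrableOn_one_sub_cos H _).add (integrableOn_one_sub_cos H _)).sub
        (integrableOn_one_sub_cos H _)
    · simp only [hk, if_neg h]
      exact integrableOn_zero
  have hkv : ∀ p q, ∫ ξ in Ioi (0 : ℝ), k p q ξ = 2 * I * genInner H p q := by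
    intro p q
    by_cases h : p.2 = q.2
    · simp only [hk, if_pos h, genInner, fbmCov]
      have i1 := integrableOn_one_sub_cos H p.1
      have i2 := integrableOn_one_sub_cos H q.1
      have i3 := integrableOn_one_sub_cos H (p.1 - q.1)
      refine (integral_sub (i1.add i2) i3).trans ?_
      refine (congrArg (fun z => z - _) (integral_add i1 i2)).trans ?_
      rw [integral_one_sub_cos, integral_one_sub_cos H q.1,
        integral_one_sub_cos H (p.1 - q.1), ← hI]
      ring
    · simp [hk, if_neg h, genInner]
  have hsum : 2 * I * (a.sum fun p α => a.sum fun q β => α * β * genInner H p q) =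
      ∫ ξ in Ioi (0 : ℝ), ∑ p ∈ a.support, ∑ q ∈ a.support, a p * a q * k p q ξ := by
    rw [integral_finsetSum _ fun p _ => integrable_finsetSum _ fun q _ => (hki p q).const_mul _]
    simp only [Finsupp.sum, Finset.mul_sum]
    refine Finset.sum_congr rfl fun p _ => ?_
    rw [integral_finsetSum _ fun q _ => (hki p q).const_mul _]
    refine Finset.sum_congr rfl fun q _ => ?_
    rw [integral_const_mul, hkv]
    ring
  have hnn : 0 ≤ ∫ ξ in Ioi (0 : ℝ),
      ∑ p ∈ a.support, ∑ q ∈ a.support, a p * a q * k p q ξ := by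
    refine setIntegral_nonneg measurableSet_Ioi fun ξ hξ => ?_
    have e : ∑ p ∈ a.support, ∑ q ∈ a.support, a p * a q * k p q ξ =
        ξ ^ (-1 - 2 * (H : ℝ)) *
        ((∑ p ∈ a.support, ∑ q ∈ a.support, if p.2 = q.2 then
            (a p * (1 - Real.cos (p.1 * ξ))) * (a q * (1 - Real.cos (q.1 * ξ))) else 0) +
         (∑ p ∈ a.support, ∑ q ∈ a.support, if p.2 = q.2 then
            (a p * Real.sin (p.1 * ξ)) * (a q * Real.sin (q.1 * ξ)) else 0)) := by
      simp only [← Finset.sum_add_distrib, Finset.mul_sum]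
      refine Finset.sum_congr rfl fun p _ => Finset.sum_congr rfl fun q _ => ?_
      by_cases h : p.2 = q.2
      · simp only [hk, if_pos h, sub_mul p.1, Real.cos_sub]
        ring
      · simp [hk, if_neg h]
    rw [e]
    exact mul_nonneg (Real.rpow_nonneg (le_of_lt hξ) _) (add_nonneg
      (sum_ite_mul_nonneg a.support fun p => a p * (1 - Real.cos (p.1 * ξ)))
      (sum_ite_mul_nonneg a.support fun p => a p * Real.sin (p.1 * ξ)))
  rw [← hsum] at hnn
  exact nonneg_of_mul_nonneg_right hnn (by positivity)

/-! ### The Hilbert space `𝓗` -/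

/-- The linear span of the indicator functions `1_{[0,t]×{x}}`, `t ∈ ℝ`, `x ∈ ℤ^d` (with
`1_{[0,t]×{x}} := -1_{[t,0]×{x}}` for `t < 0`).  These functions are linearly independent, so their
span is the space of formal finite linear combinations of the pairs `(t, x)`. -/
def StepFun (d : ℕ) (_H : HurstIndex) : Type := (ℝ × Site d) →₀ ℝ

instance (d : ℕ) (H : HurstIndex) : AddCommGroup (StepFun d H) :=
  inferInstanceAs (AddCommGroup ((ℝ × Site d) →₀ ℝ))

instance (d : ℕ) (H : HurstIndex) : Module ℝ (StepFun d H) :=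
  inferInstanceAs (Module ℝ ((ℝ × Site d) →₀ ℝ))

/-- The scalar product on step functions which extends
`⟨1_{[0,t]×{x}}, 1_{[0,s]×{y}}⟩ = R_H(t,s) δ_x(y)` bilinearly. -/
@[reducible] def stepCore (d : ℕ) (H : HurstIndex) : PreInnerProductSpace.Core ℝ (StepFun d H) where
  inner a b := formInner H a b
  conj_inner_symm a b := formInner_comm H b a
  re_inner_nonneg a := formInner_self_nonneg H a
  add_left a b c := formInner_add_left H a b c
  smul_left a b r := formInner_smul_left H a b r

instance (d : ℕ) (H : HurstIndex) : SeminormedAddCommGroup (StepFun d H) :=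
  @InnerProductSpace.Core.toSeminormedAddCommGroup ℝ _ _ _ _ (stepCore d H)

instance (d : ℕ) (H : HurstIndex) : InnerProductSpace ℝ (StepFun d H) :=
  InnerProductSpace.ofCore (stepCore d H)

/-- The Hilbert space `𝓗`: the (Hausdorff) completion of the space of step functions. -/
abbrev NoiseSpace (d : ℕ) (H : HurstIndex) : Type := UniformSpace.Completion (StepFun d H)

/-- The element `1_{[0,t]×{x}}` of the space of step functions. -/
def stepInd {d : ℕ} (H : HurstIndex) (t : ℝ) (x : Site d) : StepFun d H :=
  Finsupp.single (t, x) (1 : ℝ)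

lemma inner_stepInd {d : ℕ} (H : HurstIndex) (t s : ℝ) (x y : Site d) :
    inner ℝ ((stepInd H t x : StepFun d H) : NoiseSpace d H) (stepInd H s y : StepFun d H) =
      if x = y then fbmCov H t s else 0 := by
  rw [UniformSpace.Completion.inner_coe]
  change formInner H (Finsupp.single (t, x) 1) (Finsupp.single (s, y) 1) = _
  simp [formInner, genInner]

/-! ### The noise -/

variable {d : ℕ} {Ω Ω' : Type*} [MeasurableSpace Ω] [MeasurableSpace Ω']

/-- `{W(t,x) ; t ∈ ℝ}`, `x ∈ ℤ^d`, is a family of independent (two-sided) fractional Brownian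
motions of Hurst parameter `H`: centred Gaussian processes with continuous sample paths and
covariance function `R_H`. -/
structure IsFBMField (H : HurstIndex) (W : ℝ → Site d → Ω → ℝ) (P : Measure Ω) : Prop where
  measurable : ∀ t x, Measurable (W t x)
  gaussian : ∀ x, IsGaussianProcess (fun t => W t x) P
  mean_zero : ∀ t x, ∫ ω, W t x ω ∂P = 0
  cov_eq : ∀ t s x, ∫ ω, W t x ω * W s x ω ∂P = fbmCov H t s
  continuous_paths : ∀ x ω, Continuous fun t => W t x ω
  indep : iIndepFun (fun (x : Site d) (ω : Ω) (t : ℝ) => W t x ω) P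

lemma IsFBMField.memLp {H : HurstIndex} {W : ℝ → Site d → Ω → ℝ} {P : Measure Ω}
    (hW : IsFBMField H W P) (p : ℝ × Site d) : MemLp (W p.1 p.2) 2 P :=
  ((hW.gaussian p.2).hasGaussianLaw_eval p.1).memLp_two

/-- The linear map on step functions determined by `1_{[0,t]×{x}} ↦ W(t,x)`. -/
def stepNoise {H : HurstIndex} {W : ℝ → Site d → Ω → ℝ} {P : Measure Ω}
    (hW : IsFBMField H W P) : StepFun d H →ₗ[ℝ] Lp ℝ 2 P :=
  Finsupp.linearCombination ℝ fun p : ℝ × Site d => (hW.memLp p).toLp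

lemma inner_noise {H : HurstIndex} {W : ℝ → Site d → Ω → ℝ} {P : Measure Ω}
    (hW : IsFBMField H W P) (p q : ℝ × Site d) :
    inner ℝ ((hW.memLp p).toLp (W p.1 p.2)) ((hW.memLp q).toLp (W q.1 q.2)) = genInner H p q := by
  have e : inner ℝ ((hW.memLp p).toLp (W p.1 p.2)) ((hW.memLp q).toLp (W q.1 q.2)) =
      ∫ ω, W p.1 p.2 ω * W q.1 q.2 ω ∂P := by
    rw [L2.inner_def]
    refine integral_congr_ae ?_
    filter_upwards [(hW.memLp p).coeFn_toLp, (hW.memLp q).coeFn_toLp] with ω h1 h2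
    rw [h1, h2, real_inner_comm]
    rfl
  rw [e]
  unfold genInner
  by_cases h : p.2 = q.2
  · rw [if_pos h, ← h]
    exact hW.cov_eq _ _ _
  · rw [if_neg h]
    have hi : IndepFun (W p.1 p.2) (W q.1 q.2) P :=
      (hW.indep.indepFun h).comp (φ := fun w : ℝ → ℝ => w p.1) (ψ := fun w : ℝ → ℝ => w q.1)
        (measurable_pi_apply _) (measurable_pi_apply _)
    rw [hi.integral_fun_mul_eq_mul_integral (hW.measurable _ _).aestronglyMeasurable
      (hW.measurable _ _).aestronglyMeasurable, hW.mean_zero, zero_mul]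

lemma inner_linearCombination {H : HurstIndex} {W : ℝ → Site d → Ω → ℝ} {P : Measure Ω}
    (hW : IsFBMField H W P) (a : (ℝ × Site d) →₀ ℝ) :
    inner ℝ (Finsupp.linearCombination ℝ (fun p : ℝ × Site d => (hW.memLp p).toLp) a)
      (Finsupp.linearCombination ℝ (fun p : ℝ × Site d => (hW.memLp p).toLp) a) =
      formInner H a a := by
  simp only [Finsupp.linearCombination_apply, Finsupp.sum, sum_inner, inner_sum,
    real_inner_smul_left, real_inner_smul_right, formInner]
  refine Finset.sum_congr rfl fun p _ => Finset.sum_congr rfl fun q _ => ?_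
  rw [inner_noise hW q p, genInner_symm]
  ring

lemma norm_stepNoise {H : HurstIndex} {W : ℝ → Site d → Ω → ℝ} {P : Measure Ω}
    (hW : IsFBMField H W P) (a : StepFun d H) :
    ‖stepNoise hW a‖ = ‖(UniformSpace.Completion.toComplₗᵢ (𝕜 := ℝ) (E := StepFun d H)) a‖ := by
  have h : ‖stepNoise hW a‖ ^ 2 = ‖a‖ ^ 2 := by
    rw [← real_inner_self_eq_norm_sq, ← real_inner_self_eq_norm_sq]
    exact inner_linearCombination hW a
  rw [LinearIsometry.norm_map]
  exact (sq_eq_sq₀ (norm_nonneg _) (norm_nonneg _)).1 h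

/-- The map `𝐖 : 𝓗 → L²(P)`, the continuous linear extension of `1_{[0,t]×{x}} ↦ W(t,x)`. -/
def noise {H : HurstIndex} {W : ℝ → Site d → Ω → ℝ} {P : Measure Ω}
    (hW : IsFBMField H W P) : NoiseSpace d H →L[ℝ] Lp ℝ 2 P :=
  (stepNoise hW).extendOfNorm
    (UniformSpace.Completion.toComplₗᵢ (𝕜 := ℝ) (E := StepFun d H)).toLinearMap

/-- `𝐖(1_{[0,t]×{x}}) = W(t,x)`. -/
lemma noise_stepInd {H : HurstIndex} {W : ℝ → Site d → Ω → ℝ} {P : Measure Ω}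
    (hW : IsFBMField H W P) (t : ℝ) (x : Site d) :
    noise hW ((stepInd H t x : StepFun d H) : NoiseSpace d H) = (hW.memLp (t, x)).toLp := by
  refine (LinearMap.extendOfNorm_eq UniformSpace.Completion.denseRange_coe
    ⟨1, fun a => ?_⟩ (stepInd H t x)).trans ?_
  · rw [one_mul]
    exact (norm_stepNoise hW a).le
  · exact (Finsupp.linearCombination_single ℝ (1 : ℝ) (t, x)).trans (one_smul ℝ _)

/-- `𝐖` is an isometry. -/
lemma norm_noise {H : HurstIndex} {W : ℝ → Site d → Ω → ℝ} {P : Measure Ω}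
    (hW : IsFBMField H W P) (φ : NoiseSpace d H) : ‖noise hW φ‖ = ‖φ‖ := by
  refine UniformSpace.Completion.induction_on φ
    (isClosed_eq (noise hW).continuous.norm continuous_norm) fun a => ?_
  have := LinearMap.extendOfNorm_eq (f := stepNoise hW)
    (e := (UniformSpace.Completion.toComplₗᵢ (𝕜 := ℝ) (E := StepFun d H)).toLinearMap)
    UniformSpace.Completion.denseRange_coe
    ⟨1, fun a => by rw [one_mul]; exact (norm_stepNoise hW a).le⟩ a
  exact (congrArg norm this).trans (norm_stepNoise hW a)

/-! ### The Malliavin derivative -/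

/-- The data of a smooth random variable `f(𝐖(φ₁), …, 𝐖(φ_n))`: elements `φ_i` of `𝓗` and a
smooth function `f` on `ℝⁿ` which, with all its derivatives, has polynomial growth. -/
structure SmoothData (d : ℕ) (H : HurstIndex) where
  n : ℕ
  φ : Fin n → NoiseSpace d H
  f : (Fin n → ℝ) → ℝ
  growth : Function.HasTemperateGrowth f

/-- The random variable `f(𝐖(φ₁), …, 𝐖(φ_n))`. -/
def SmoothData.eval {H : HurstIndex} {W : ℝ → Site d → Ω → ℝ} {P : Measure Ω}
    (hW : IsFBMField H W P) (S : SmoothData d H) (ω : Ω) : ℝ :=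
  S.f fun i => noise hW (S.φ i) ω

/-- The `𝓗`-valued random variable `∑ i, ∂_i f(𝐖(φ₁), …, 𝐖(φ_n)) φ_i`. -/
def SmoothData.grad {H : HurstIndex} {W : ℝ → Site d → Ω → ℝ} {P : Measure Ω}
    (hW : IsFBMField H W P) (S : SmoothData d H) (ω : Ω) : NoiseSpace d H :=
  ∑ i, (fderiv ℝ S.f (fun j => noise hW (S.φ j) ω) (Pi.single i 1)) • S.φ i

/-- `F` belongs to `𝔻^{1,2}` and `∇F = G`: the pair `(F, G)` is in the closure, in
`L²(P) × L²(P; 𝓗)`, of the graph of the derivative on smooth random variables. -/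
structure HasMalliavinDeriv {H : HurstIndex} {W : ℝ → Site d → Ω → ℝ} {P : Measure Ω}
    (hW : IsFBMField H W P) (F : Ω → ℝ) (G : Ω → NoiseSpace d H) : Prop where
  memLp : MemLp F 2 P
  memLp_deriv : MemLp G 2 P
  approx : ∀ δ : ℝ≥0∞, 0 < δ → ∃ S : SmoothData d H,
    eLpNorm (fun ω => F ω - S.eval hW ω) 2 P ≤ δ ∧
      eLpNorm (fun ω => G ω - S.grad hW ω) 2 P ≤ δ

/-- The space `𝔻^{1,2}`. -/
def MemD12 {H : HurstIndex} {W : ℝ → Site d → Ω → ℝ} {P : Measure Ω}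
    (hW : IsFBMField H W P) (F : Ω → ℝ) : Prop :=
  ∃ G, HasMalliavinDeriv hW F G

/-! ### The random walk -/

/-- The holding times `τ` and the steps `ξ` of a continuous-time simple random walk on `ℤ^d` with
jump rate `κ`: independent sequences, `τ` i.i.d. exponential of rate `κ` and `ξ` i.i.d. uniform on
the `2d` unit vectors `±e_i`. -/
structure IsSimpleWalkData (κ : ℝ) (τ : ℕ → Ω' → ℝ) (ξ : ℕ → Ω' → Site d) (Q : Measure Ω') :
    Prop where
  holding_law : ∀ n, HasLaw (τ n) (expMeasure κ) Q
  step_law : ∀ n, HasLaw (ξ n) (uniformOn {e : Site d | ∑ i, |e i| = 1}) Q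
  holding_indep : iIndepFun τ Q
  step_indep : iIndepFun ξ Q
  indep : IndepFun (fun ω' n => τ n ω') (fun ω' n => ξ n ω') Q

/-- The time of the `n`-th jump (and `0` for `n = 0`). -/
def jumpTime (τ : ℕ → ℝ) (n : ℕ) : ℝ := ∑ i ∈ Finset.range n, τ i

/-- The number of jumps in `[0,t]`. -/
def jumpCount (τ : ℕ → ℝ) (t : ℝ) : ℕ := {n : ℕ | jumpTime τ (n + 1) ≤ t}.ncard

/-- The position after `n` jumps of the walk started at `x`. -/
def skeleton (x : Site d) (ξ : ℕ → Site d) (n : ℕ) : Site d := x + ∑ i ∈ Finset.range n, ξ i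

/-- The position `X(t)` at time `t` of the walk started at `x`. -/
def walk (x : Site d) (τ : ℕ → ℝ) (ξ : ℕ → Site d) (t : ℝ) : Site d :=
  skeleton x ξ (jumpCount τ t)

/-! ### The Feynman–Kac fields -/

/-- `∫_0^t w(ds, X(t-s))`.  If `S_k` is the `k`-th jump time of `X`, `X_k` its position after `k`
jumps and `N` the number of jumps in `[0,t]`, then `s ↦ X(t-s)` equals `X_k` between the times
`t - min(S_{k+1}, t)` and `t - S_k`, for `k = 0, …, N`, and the integral is the sum of the
increments of `w(·, X_k)` between these times. -/
def walkIntegral (w : ℝ → Site d → ℝ) (x : Site d) (τ : ℕ → ℝ) (ξ : ℕ → Site d) (t : ℝ) : ℝ :=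
  ∑ k ∈ Finset.range (jumpCount τ t + 1),
    (w (t - jumpTime τ k) (skeleton x ξ k) - w (t - min (jumpTime τ (k + 1)) t) (skeleton x ξ k))

/-- The symmetric difference quotient `(w(t+ε,x) - w(t-ε,x)) / (2ε)`. -/
def smoothedDeriv (w : ℝ → Site d → ℝ) (ε t : ℝ) (x : Site d) : ℝ :=
  (w (t + ε) x - w (t - ε) x) / (2 * ε)

/-- `u₀(X(t)) exp ∫_0^t W(ds, X(t-s))`, for one path of the noise and one of the walk. -/
def fkWeight (u₀ : Site d → ℝ) (w : ℝ → Site d → ℝ) (x : Site d) (t : ℝ)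
    (τ : ℕ → ℝ) (ξ : ℕ → Site d) : ℝ :=
  u₀ (walk x τ ξ t) * Real.exp (walkIntegral w x τ ξ t)

/-- `u₀(X(t)) exp ∫_0^t Ẇ_ε(s, X(t-s)) ds`, for one path of the noise and one of the walk. -/
def fkWeightSmoothed (u₀ : Site d → ℝ) (w : ℝ → Site d → ℝ) (ε : ℝ) (x : Site d) (t : ℝ)
    (τ : ℕ → ℝ) (ξ : ℕ → Site d) : ℝ :=
  u₀ (walk x τ ξ t) * Real.exp (∫ s in (0 : ℝ)..t, smoothedDeriv w ε s (walk x τ ξ (t - s)))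

/-- The Feynman–Kac field `u(t,x) = 𝔼^x[u₀(X(t)) exp ∫_0^t W(ds, X(t-s))]`. -/
def fk (u₀ : Site d → ℝ) (W : ℝ → Site d → Ω → ℝ) (τ : ℕ → Ω' → ℝ) (ξ : ℕ → Ω' → Site d)
    (Q : Measure Ω') (t : ℝ) (x : Site d) (ω : Ω) : ℝ :=
  ∫ ω', fkWeight u₀ (fun r y => W r y ω) x t (fun n => τ n ω') (fun n => ξ n ω') ∂Q

/-- The field `u_ε(t,x) = 𝔼^x[u₀(X(t)) exp ∫_0^t Ẇ_ε(s, X(t-s)) ds]`. -/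
def fkSmoothed (u₀ : Site d → ℝ) (W : ℝ → Site d → Ω → ℝ) (τ : ℕ → Ω' → ℝ) (ξ : ℕ → Ω' → Site d)
    (Q : Measure Ω') (ε t : ℝ) (x : Site d) (ω : Ω) : ℝ :=
  ∫ ω', fkWeightSmoothed u₀ (fun r y => W r y ω) ε x t (fun n => τ n ω') (fun n => ξ n ω') ∂Q

end FractionalPAM

end

open FractionalPAM

/-! For a fixed path of the walk both exponents are Gaussian variables `𝐖(Φ)` with `Φ ∈ 𝓗`. For `u`,
`Φ` is the sum of the increments of `ind H` along the path. For `u_ε` it is the same sum for the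
mollified field `mollify ε (ind H)`, because integrating a symmetric difference quotient over an
interval gives an increment of the running average. Everything then rests on the map `φ ↦ (exp 𝐖(φ),
exp 𝐖(φ) φ)` from `𝓗` to `L²(P) × L²(P; 𝓗)`, called `expPair`.

This map takes values in the closed graph of `∇` (`expPair_mem_closure`, by Taylor polynomials), and
on the ball `‖φ‖² ≤ R` it is Lipschitz with constant `exp (3R + 2)` (`norm_expPair_sub_le`, an
explicit Gaussian computation). A Bochner integral over the paths of the walk stays in a closed
subspace, so `fkPair` is at once the field and its derivative.

Convergence is then an estimate in `𝓗`. With `N` the number of jumps before `T`, the two elements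
differ by at most `2(N+1)ε^H`, and both have squared norm at most `(N+1)T^{2H}`
(`norm_sum_increments_sq_le`). Linearity in `N` is essential: `N` has exponential moments of every
order (`integrable_exp_jumpCount`), whereas for `H < 1/2` the triangle inequality would give only
the order `N^{2-2H}`, whose exponential is not integrable. The linear bound comes from the sign of
the correlations of increments: negative for `H ≤ 1/2`, so off-diagonal terms can be dropped;
positive for `H ≥ 1/2`, so all sites can be merged into one and the sum telescopes. The result is a
rate `K ε^H`, uniform on `[0,T]` (`exists_norm_fkPair_sub_le`). -/

noncomputable section

namespace FractionalPAM

/-! ### Gaussian law and exponential moments of `𝐖(φ)`. -/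

section NoiseLaw

variable {d : ℕ} {Ω : Type*} [MeasurableSpace Ω] {H : HurstIndex} {W : ℝ → Site d → Ω → ℝ}
  {P : Measure Ω}

lemma noise_coe (hW : IsFBMField H W P) (a : StepFun d H) :
    noise hW (a : NoiseSpace d H) = stepNoise hW a :=
  LinearMap.extendOfNorm_eq (f := stepNoise hW)
    (e := (UniformSpace.Completion.toComplₗᵢ (𝕜 := ℝ) (E := StepFun d H)).toLinearMap)
    UniformSpace.Completion.denseRange_coe
    ⟨1, fun a => by rw [one_mul]; exact (norm_stepNoise hW a).le⟩ a

lemma stepNoise_ae_eq (hW : IsFBMField H W P) (a : (ℝ × Site d) →₀ ℝ) :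
    (stepNoise hW a : Ω → ℝ) =ᵐ[P] fun ω => ∑ p ∈ a.support, a p * W p.1 p.2 ω := by
  have h1 : stepNoise hW a = ∑ p ∈ a.support, a p • (hW.memLp p).toLp (W p.1 p.2) :=
    Finsupp.linearCombination_apply ℝ a
  rw [h1]
  refine (Lp.coeFn_finsetSum _ _).trans ?_
  have h2 : ∀ᵐ ω ∂P, ∀ p ∈ a.support,
      (a p • (hW.memLp p).toLp (W p.1 p.2) : Lp ℝ 2 P) ω = a p * W p.1 p.2 ω := by
    rw [Filter.eventually_all_finset]
    intro p _
    filter_upwards [Lp.coeFn_smul (a p) ((hW.memLp p).toLp (W p.1 p.2)),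
      (hW.memLp p).coeFn_toLp] with ω e1 e2
    rw [e1, Pi.smul_apply, e2, smul_eq_mul]
  filter_upwards [h2] with ω h
  rw [Finset.sum_apply]
  exact Finset.sum_congr rfl h

lemma integral_noise_sq (hW : IsFBMField H W P) (φ : NoiseSpace d H) :
    ∫ ω, noise hW φ ω ^ 2 ∂P = ‖φ‖ ^ 2 := by
  rw [← norm_noise hW φ, ← real_inner_self_eq_norm_sq, L2.inner_def]
  refine integral_congr_ae (ae_of_all _ fun ω => ?_)
  simp

/-- Grouping the terms by site gives one Gaussian variable per site, since each `W(·,x)` is a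
Gaussian process, and these variables are independent across sites. -/
lemma hasGaussianLaw_stepNoise (hW : IsFBMField H W P) (a : (ℝ × Site d) →₀ ℝ) :
    HasGaussianLaw (stepNoise hW a : Ω → ℝ) P := by
  refine HasGaussianLaw.congr ?_ (stepNoise_ae_eq hW a).symm
  classical
  set I : Finset (Site d) := a.support.image Prod.snd
  have hsum : (fun ω => ∑ p ∈ a.support, a p * W p.1 p.2 ω) =
      fun ω => ∑ x : I, ∑ p ∈ a.support with p.2 = (x : Site d), a p * W p.1 x ω := by
    funext ω
    refine Eq.trans ?_ (Finset.sum_coe_sort I (fun x =>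
      ∑ p ∈ a.support with p.2 = x, a p * W p.1 x ω)).symm
    rw [← Finset.sum_fiberwise_of_maps_to (t := I) (g := Prod.snd)
      (fun p hp => Finset.mem_image_of_mem _ hp)]
    refine Finset.sum_congr rfl fun x _ => Finset.sum_congr rfl fun p hp => ?_
    rw [(Finset.mem_filter.1 hp).2]
  rw [hsum]
  refine iIndepFun.hasGaussianLaw_fun_sum (X := fun (x : I) ω =>
    ∑ p ∈ a.support with p.2 = (x : Site d), a p * W p.1 x ω) (fun x => ?_) ?_
  · set J := a.support.filter (fun p => p.2 = (x : Site d))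
    have hg := ((hW.gaussian x).comp_right (Prod.fst : ℝ × Site d → ℝ)).smul a
    exact hg.hasGaussianLaw_fun_sum (I := J)
  · have h := hW.indep.precomp (g := fun x : I => (x : Site d)) Subtype.val_injective
    exact h.comp (fun (x : I) (w : ℝ → ℝ) => ∑ p ∈ a.support with p.2 = (x : Site d), a p * w p.1)
      (fun x => Finset.measurable_sum _ fun p _ => (measurable_pi_apply _).const_mul _)

variable [IsProbabilityMeasure P]

lemma integral_noise (hW : IsFBMField H W P) (φ : NoiseSpace d H) : ∫ ω, noise hW φ ω ∂P = 0 := by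
  have hc : Continuous fun f : Lp ℝ 2 P => ∫ ω, f ω ∂P := by
    have e : (fun f : Lp ℝ 2 P => ∫ ω, f ω ∂P) =
        fun f => inner ℝ (indicatorConstLp 2 MeasurableSet.univ (measure_ne_top P _) (1 : ℝ)) f := by
      funext f
      rw [L2.inner_indicatorConstLp_one, setIntegral_univ]
    rw [e]
    fun_prop
  refine UniformSpace.Completion.induction_on φ
    (isClosed_eq (hc.comp (noise hW).continuous) continuous_const) fun a => ?_
  rw [noise_coe, integral_congr_ae (stepNoise_ae_eq hW a), integral_finsetSum]
  · refine Finset.sum_eq_zero fun p _ => ?_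
    rw [integral_const_mul, hW.mean_zero, mul_zero]
  · exact fun p _ => ((hW.memLp p).integrable one_le_two).const_mul _

lemma integral_norm_Lp_two_le (f : Lp ℝ 2 P) : ∫ ω, ‖f ω‖ ∂P ≤ ‖f‖ := by
  rw [Lp.norm_def, integral_norm_eq_lintegral_enorm (Lp.aestronglyMeasurable _),
    ← eLpNorm_one_eq_lintegral_enorm]
  exact ENNReal.toReal_mono (Lp.eLpNorm_ne_top _)
    (eLpNorm_le_eLpNorm_of_exponent_le one_le_two (Lp.aestronglyMeasurable _))

/-- Continuity of the characteristic function under `L²` convergence. -/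
lemma continuous_integral_cexp_Lp (θ : ℝ) :
    Continuous fun f : Lp ℝ 2 P => ∫ ω, Complex.exp (θ * f ω * Complex.I) ∂P := by
  have hint : ∀ f : Lp ℝ 2 P, Integrable (fun ω => Complex.exp (θ * f ω * Complex.I)) P := by
    intro f
    refine Integrable.of_bound (C := 1) ?_ (ae_of_all _ fun ω => ?_)
    · have hm : Continuous fun x : ℝ => Complex.exp (θ * x * Complex.I) := by fun_prop
      exact hm.comp_aestronglyMeasurable (Lp.aestronglyMeasurable f)
    · rw [← Complex.ofReal_mul, Complex.norm_exp_ofReal_mul_I]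
  have key : LipschitzWith (Real.nnabs θ) fun f : Lp ℝ 2 P =>
      ∫ ω, Complex.exp (θ * f ω * Complex.I) ∂P := by
    refine LipschitzWith.of_dist_le_mul fun f g => ?_
    rw [dist_eq_norm, dist_eq_norm, ← integral_sub (hint f) (hint g)]
    have hi : Integrable (fun ω => ‖(f - g : Lp ℝ 2 P) ω‖) P :=
      ((Lp.memLp (f - g)).integrable one_le_two).norm
    calc _ ≤ ∫ ω, |θ| * ‖(f - g : Lp ℝ 2 P) ω‖ ∂P := by
          refine norm_integral_le_of_norm_le (hi.const_mul _) ?_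
          filter_upwards [Lp.coeFn_sub f g] with ω h
          rw [h, Pi.sub_apply]
          have e : Complex.exp (θ * f ω * Complex.I) - Complex.exp (θ * g ω * Complex.I) =
              Complex.exp (θ * g ω * Complex.I) *
                (Complex.exp (Complex.I * ((θ * (f ω - g ω) : ℝ) : ℂ)) - 1) := by
            rw [mul_sub, ← Complex.exp_add, mul_one]
            congr 2
            push_cast
            ring
          rw [e, norm_mul, ← Complex.ofReal_mul, Complex.norm_exp_ofReal_mul_I, one_mul]
          refine Real.norm_exp_I_mul_ofReal_sub_one_le.trans ?_
          rw [norm_mul, Real.norm_eq_abs θ]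
      _ = |θ| * ∫ ω, ‖(f - g : Lp ℝ 2 P) ω‖ ∂P := integral_const_mul _ _
      _ ≤ |θ| * ‖f - g‖ := by
          gcongr
          exact integral_norm_Lp_two_le _
  exact key.continuous

/-- Both characteristic functions depend continuously on `φ`, so it suffices to compare them on the
dense set of step functions, where the law is Gaussian with known mean and variance. -/
lemma map_noise (hW : IsFBMField H W P) (φ : NoiseSpace d H) :
    P.map (noise hW φ) = gaussianReal 0 (‖φ‖₊ ^ 2) := by
  have hm : ∀ f : Lp ℝ 2 P, AEMeasurable f P := fun f => (Lp.aestronglyMeasurable f).aemeasurable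
  have hcf : ∀ f : Lp ℝ 2 P, ∀ θ : ℝ, charFun (P.map f) θ =
      ∫ ω, Complex.exp (θ * f ω * Complex.I) ∂P := by
    intro f θ
    rw [charFun_apply_real, integral_map (hm f)]
    exact (by fun_prop : Continuous fun x : ℝ =>
      Complex.exp (θ * x * Complex.I)).aestronglyMeasurable
  have : IsProbabilityMeasure (P.map (noise hW φ)) := Measure.isProbabilityMeasure_map (hm _)
  refine Measure.ext_of_charFun (funext fun θ => ?_)
  rw [hcf, charFun_gaussianReal]
  refine UniformSpace.Completion.induction_on φ (isClosed_eq
    ((continuous_integral_cexp_Lp θ).comp (noise hW).continuous) ?_) fun a => ?_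
  · simp only [NNReal.coe_pow, coe_nnnorm]
    fun_prop
  · have hg := hasGaussianLaw_stepNoise hW a
    rw [← noise_coe] at hg
    have h := hg.map_eq_gaussianReal
    rw [integral_noise, variance_of_integral_eq_zero (hm _) (integral_noise hW _),
      integral_noise_sq] at h
    rw [← hcf, h, charFun_gaussianReal]
    congr
    rw [Real.toNNReal_pow (norm_nonneg _), norm_toNNReal]

lemma integrable_exp_noise (hW : IsFBMField H W P) (φ : NoiseSpace d H) (c : ℝ) :
    Integrable (fun ω => Real.exp (c * noise hW φ ω)) P := by
  have h := integrable_exp_mul_gaussianReal (μ := 0) (v := ‖φ‖₊ ^ 2) c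
  rw [← map_noise hW φ] at h
  exact h.comp_aemeasurable (Lp.aestronglyMeasurable _).aemeasurable

lemma integral_exp_noise (hW : IsFBMField H W P) (φ : NoiseSpace d H) (c : ℝ) :
    ∫ ω, Real.exp (c * noise hW φ ω) ∂P = Real.exp (c ^ 2 * ‖φ‖ ^ 2 / 2) := by
  have h := mgf_gaussianReal (map_noise hW φ) c
  rw [mgf] at h
  rw [h]
  congr 1
  rw [NNReal.coe_pow, coe_nnnorm]
  ring

end NoiseLaw

lemma norm_toLp_two_sq {Ω : Type*} [MeasurableSpace Ω] {P : Measure Ω} {f : Ω → ℝ} (hf : MemLp f 2 P) : ‖hf.toLp f‖ ^ 2 = ∫ ω, f ω ^ 2 ∂P := by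
  rw [← real_inner_self_eq_norm_sq, L2.inner_def]
  refine integral_congr_ae ?_
  filter_upwards [hf.coeFn_toLp] with ω h
  rw [h]
  simp

/-! ### Lipschitz and growth bounds for `φ ↦ (exp 𝐖(φ), exp 𝐖(φ) φ)`. -/

section ExponentialFunctional

variable {d : ℕ} {Ω : Type*} [MeasurableSpace Ω] {H : HurstIndex} {W : ℝ → Site d → Ω → ℝ}
  {P : Measure Ω} [IsProbabilityMeasure P]

lemma memLp_exp_noise (hW : IsFBMField H W P) (φ : NoiseSpace d H) :
    MemLp (fun ω => Real.exp (noise hW φ ω)) 2 P := by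
  rw [memLp_two_iff_integrable_sq]
  · refine (integrable_exp_noise hW φ 2).congr (ae_of_all _ fun ω => ?_)
    simp only
    rw [← Real.exp_nat_mul]
    norm_num
  · exact Real.continuous_exp.comp_aestronglyMeasurable (Lp.aestronglyMeasurable _)

/-- The random variable `exp 𝐖(φ)`, as an element of `L²(P)`. -/
def expNoise (hW : IsFBMField H W P) (φ : NoiseSpace d H) : Lp ℝ 2 P :=
  (memLp_exp_noise hW φ).toLp

lemma coeFn_expNoise (hW : IsFBMField H W P) (φ : NoiseSpace d H) :
    expNoise hW φ =ᵐ[P] fun ω => Real.exp (noise hW φ ω) :=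
  MemLp.coeFn_toLp _

/-- The product of the two exponentials is `exp 𝐖(a + b)`, whose mean is the Gaussian Laplace
transform. All `L²` distances between exponentials thereby become expressions in norms of `𝓗`. -/
lemma inner_expNoise (hW : IsFBMField H W P) (a b : NoiseSpace d H) :
    inner ℝ (expNoise hW a) (expNoise hW b) = Real.exp (‖a + b‖ ^ 2 / 2) := by
  rw [L2.inner_def]
  have h := integral_exp_noise hW (a + b) 1
  simp only [one_mul, one_pow] at h
  rw [← h]
  refine integral_congr_ae ?_
  rw [map_add]
  filter_upwards [coeFn_expNoise hW a, coeFn_expNoise hW b,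
    Lp.coeFn_add (noise hW a) (noise hW b)] with ω h1 h2 h3
  rw [h1, h2, h3, Pi.add_apply, Real.exp_add]
  simp [mul_comm]

lemma norm_expNoise (hW : IsFBMField H W P) (a : NoiseSpace d H) :
    ‖expNoise hW a‖ = Real.exp (‖a‖ ^ 2) := by
  rw [← sq_eq_sq₀ (norm_nonneg _) (Real.exp_nonneg _), ← real_inner_self_eq_norm_sq,
    inner_expNoise, ← Real.exp_nat_mul, ← two_smul ℝ a, norm_smul]
  congr 1
  norm_num
  ring

lemma abs_exp_sub_exp_le {α β R : ℝ} (hα : α ≤ R) (hβ : β ≤ R) :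
    |Real.exp α - Real.exp β| ≤ |α - β| * Real.exp R := by
  have key : ∀ {α β : ℝ}, β ≤ α → α ≤ R → |Real.exp α - Real.exp β| ≤ |α - β| * Real.exp R := by
    intro α β h hα
    rw [abs_of_nonneg (sub_nonneg.2 (Real.exp_le_exp.2 h)), abs_of_nonneg (sub_nonneg.2 h)]
    have h1 : Real.exp β = Real.exp α * Real.exp (β - α) := by rw [← Real.exp_add]; ring_nf
    have h2 := Real.add_one_le_exp (β - α)
    have h3 := Real.exp_le_exp.2 hα
    have h4 := Real.exp_pos α
    rw [h1]
    nlinarith [mul_le_mul_of_nonneg_left h2 h4.le, mul_le_mul_of_nonneg_left h3 (sub_nonneg.2 h)]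
  rcases le_total β α with h | h
  · exact key h hα
  · rw [abs_sub_comm, abs_sub_comm α]
    exact key h hβ

/-- With `α = ‖a‖²`, `β = ‖b‖²`, `δ = ‖a - b‖`, the parallelogram law turns the squared distance
into `(e^α - e^β)² + 2 e^{α+β}(1 - e^{-δ²/2})`. The first term is at most `(2ρδ e^{ρ²})²`, the
second at most `δ² e^{2ρ²}`. -/
lemma norm_expNoise_sub_le (hW : IsFBMField H W P) {a b : NoiseSpace d H} {ρ : ℝ}
    (ha : ‖a‖ ≤ ρ) (hb : ‖b‖ ≤ ρ) :
    ‖expNoise hW a - expNoise hW b‖ ≤ ‖a - b‖ * (Real.exp (ρ ^ 2) * (1 + 2 * ρ)) := by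
  have hρ : 0 ≤ ρ := (norm_nonneg a).trans ha
  have ha2 : ‖a‖ ^ 2 ≤ ρ ^ 2 := by gcongr
  have hb2 : ‖b‖ ^ 2 ≤ ρ ^ 2 := by gcongr
  refine abs_le_of_sq_le_sq' ?_ (by positivity) |>.2
  rw [norm_sub_sq_real, inner_expNoise, norm_expNoise, norm_expNoise]
  set α := ‖a‖ ^ 2
  set β := ‖b‖ ^ 2
  set δ := ‖a - b‖ with hδ
  have hδ0 : 0 ≤ δ := norm_nonneg _
  have hpar : ‖a + b‖ ^ 2 / 2 = α + β + -(δ ^ 2 / 2) := by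
    have := parallelogram_law_with_norm ℝ a b
    simp only [α, β, hδ]
    linarith
  rw [hpar, Real.exp_add, Real.exp_add]
  have h1 : 1 - δ ^ 2 / 2 ≤ Real.exp (-(δ ^ 2 / 2)) := by
    linarith [Real.add_one_le_exp (-(δ ^ 2 / 2))]
  have h2 : |α - β| ≤ δ * (2 * ρ) := by
    have : α - β = (‖a‖ - ‖b‖) * (‖a‖ + ‖b‖) := by simp only [α, β]; ring
    rw [this, abs_mul, abs_of_nonneg (by positivity : 0 ≤ ‖a‖ + ‖b‖)]
    gcongr
    · exact abs_norm_sub_norm_le a b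
    · linarith
  have h3 : |Real.exp α - Real.exp β| ≤ δ * (2 * ρ) * Real.exp (ρ ^ 2) :=
    (abs_exp_sub_exp_le ha2 hb2).trans (by gcongr)
  have h4 : (Real.exp α - Real.exp β) ^ 2 ≤ (δ * (2 * ρ) * Real.exp (ρ ^ 2)) ^ 2 :=
    sq_le_sq' (by linarith [neg_le_of_abs_le h3]) (le_of_abs_le h3)
  have h5 : Real.exp α * Real.exp β ≤ Real.exp (ρ ^ 2) ^ 2 := by
    rw [sq]
    gcongr
  have h6 : 0 ≤ Real.exp α * Real.exp β := by positivity
  have h7 : Real.exp α * Real.exp β * δ ^ 2 ≤ Real.exp (ρ ^ 2) ^ 2 * δ ^ 2 := by gcongr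
  have h8 : 0 ≤ Real.exp (ρ ^ 2) ^ 2 * δ ^ 2 * ρ := by positivity
  nlinarith [mul_le_mul_of_nonneg_left h1 h6]

/-- The random variable `exp 𝐖(φ) φ`, as an element of `L²(P; 𝓗)`. -/
def expNoiseGrad (hW : IsFBMField H W P) (φ : NoiseSpace d H) : Lp (NoiseSpace d H) 2 P :=
  (ContinuousLinearMap.toSpanSingleton ℝ φ).compLp (expNoise hW φ)

/-- Product rule: `e^{𝐖(a)} a - e^{𝐖(b)} b = e^{𝐖(a)} (a - b) + (e^{𝐖(a)} - e^{𝐖(b)}) b`. -/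
lemma norm_expNoiseGrad_sub_le (hW : IsFBMField H W P) {a b : NoiseSpace d H} {ρ : ℝ}
    (ha : ‖a‖ ≤ ρ) (hb : ‖b‖ ≤ ρ) :
    ‖expNoiseGrad hW a - expNoiseGrad hW b‖ ≤
      ‖a - b‖ * (Real.exp (ρ ^ 2) * (1 + ρ * (1 + 2 * ρ))) := by
  have e : expNoiseGrad hW a - expNoiseGrad hW b =
      (ContinuousLinearMap.toSpanSingleton ℝ (a - b)).compLp (expNoise hW a) +
        (ContinuousLinearMap.toSpanSingleton ℝ b).compLp (expNoise hW a - expNoise hW b) := by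
    refine Lp.ext ?_
    unfold expNoiseGrad
    filter_upwards [Lp.coeFn_sub
        ((ContinuousLinearMap.toSpanSingleton ℝ a).compLp (expNoise hW a))
        ((ContinuousLinearMap.toSpanSingleton ℝ b).compLp (expNoise hW b)),
      Lp.coeFn_add ((ContinuousLinearMap.toSpanSingleton ℝ (a - b)).compLp (expNoise hW a))
        ((ContinuousLinearMap.toSpanSingleton ℝ b).compLp (expNoise hW a - expNoise hW b)),
      (ContinuousLinearMap.toSpanSingleton ℝ a).coeFn_compLp (expNoise hW a),
      (ContinuousLinearMap.toSpanSingleton ℝ b).coeFn_compLp (expNoise hW b),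
      (ContinuousLinearMap.toSpanSingleton ℝ (a - b)).coeFn_compLp (expNoise hW a),
      (ContinuousLinearMap.toSpanSingleton ℝ b).coeFn_compLp (expNoise hW a - expNoise hW b),
      Lp.coeFn_sub (expNoise hW a) (expNoise hW b)] with ω h1 h2 h3 h4 h5 h6 h7
    rw [h1, h2, Pi.sub_apply, Pi.add_apply, h3, h4, h5, h6, h7]
    simp only [ContinuousLinearMap.toSpanSingleton_apply, Pi.sub_apply]
    module
  have hρ : 0 ≤ ρ := (norm_nonneg a).trans ha
  have h1 := (ContinuousLinearMap.toSpanSingleton ℝ (a - b)).norm_compLp_le (expNoise hW a)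
  have h2 := (ContinuousLinearMap.toSpanSingleton ℝ b).norm_compLp_le
    (expNoise hW a - expNoise hW b)
  rw [ContinuousLinearMap.norm_toSpanSingleton, norm_expNoise] at h1
  rw [ContinuousLinearMap.norm_toSpanSingleton] at h2
  have h3 : Real.exp (‖a‖ ^ 2) ≤ Real.exp (ρ ^ 2) := by gcongr
  rw [e]
  calc _ ≤ ‖a - b‖ * Real.exp (‖a‖ ^ 2) + ‖b‖ * ‖expNoise hW a - expNoise hW b‖ :=
        (norm_add_le _ _).trans (add_le_add h1 h2)
    _ ≤ ‖a - b‖ * Real.exp (ρ ^ 2) + ρ * (‖a - b‖ * (Real.exp (ρ ^ 2) * (1 + 2 * ρ))) := by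
        gcongr
        exact norm_expNoise_sub_le hW ha hb
    _ = _ := by ring

/-- The pair `(exp 𝐖(φ), exp 𝐖(φ) φ)`: an exponential functional and its derivative. -/
def expPair (hW : IsFBMField H W P) (φ : NoiseSpace d H) :
    Lp ℝ 2 P × Lp (NoiseSpace d H) 2 P :=
  (expNoise hW φ, expNoiseGrad hW φ)

/-- With `ρ = √R`, both polynomial prefactors are at most `(1 + 2ρ)² ≤ e^{4ρ} ≤ e^{2R+2}`. The point
is an exponent linear in `R`, which the exponential moments of the jump count can absorb. -/
lemma norm_expPair_sub_le (hW : IsFBMField H W P) {a b : NoiseSpace d H} {R : ℝ}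
    (ha : ‖a‖ ^ 2 ≤ R) (hb : ‖b‖ ^ 2 ≤ R) :
    ‖expPair hW a - expPair hW b‖ ≤ ‖a - b‖ * Real.exp (3 * R + 2) := by
  have hR : 0 ≤ R := (sq_nonneg _).trans ha
  set ρ := √R with hρd
  have hρ : 0 ≤ ρ := Real.sqrt_nonneg _
  have hρ2 : ρ ^ 2 = R := Real.sq_sqrt hR
  have ha' : ‖a‖ ≤ ρ := Real.le_sqrt_of_sq_le ha
  have hb' : ‖b‖ ≤ ρ := Real.le_sqrt_of_sq_le hb
  have hbd : (1 + 2 * ρ) ^ 2 ≤ Real.exp (2 * R + 2) := by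
    have h1 : 1 + 2 * ρ ≤ Real.exp (2 * ρ) := by linarith [Real.add_one_le_exp (2 * ρ)]
    calc (1 + 2 * ρ) ^ 2 ≤ Real.exp (2 * ρ) ^ 2 := by gcongr
      _ = Real.exp (4 * ρ) := by rw [← Real.exp_nat_mul]; ring_nf
      _ ≤ _ := by
        refine Real.exp_le_exp.2 ?_
        nlinarith [sq_nonneg (ρ - 1)]
  have he : Real.exp (3 * R + 2) = Real.exp (ρ ^ 2) * Real.exp (2 * R + 2) := by
    rw [← Real.exp_add, hρ2]
    ring_nf
  rw [he]
  refine max_le ?_ ?_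
  · refine (norm_expNoise_sub_le hW ha' hb').trans ?_
    gcongr
    refine le_trans ?_ hbd
    nlinarith
  · refine (norm_expNoiseGrad_sub_le hW ha' hb').trans ?_
    gcongr
    refine le_trans ?_ hbd
    nlinarith

lemma continuous_expPair (hW : IsFBMField H W P) : Continuous (expPair hW) := by
  refine continuous_iff_continuousAt.2 fun a => tendsto_iff_norm_sub_tendsto_zero.2 ?_
  have hc : Continuous fun b : NoiseSpace d H =>
      ‖b - a‖ * Real.exp (3 * (‖a‖ ^ 2 + ‖b‖ ^ 2) + 2) := by fun_prop
  have h := hc.tendsto a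
  simp only [sub_self, norm_zero, zero_mul] at h
  refine squeeze_zero (fun _ => norm_nonneg _) (fun b => ?_) h
  exact norm_expPair_sub_le hW (by linarith [sq_nonneg ‖a‖]) (by linarith [sq_nonneg ‖b‖])

/-- Comparison with the value `(1, 0)` at `0`; the factor `1 + ‖a‖ ≤ 2 + R` is absorbed by
`e^{R+1}`. -/
lemma norm_expPair_le (hW : IsFBMField H W P) {a : NoiseSpace d H} {R : ℝ} (ha : ‖a‖ ^ 2 ≤ R) :
    ‖expPair hW a‖ ≤ Real.exp (4 * R + 3) := by
  have hR : 0 ≤ R := (sq_nonneg _).trans ha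
  have h0 : ‖expPair hW (0 : NoiseSpace d H)‖ ≤ 1 := by
    refine max_le ?_ ?_
    · change ‖expNoise hW 0‖ ≤ 1
      rw [norm_expNoise]
      simp
    · refine ((ContinuousLinearMap.toSpanSingleton ℝ (0 : NoiseSpace d H)).norm_compLp_le
        (expNoise hW 0)).trans ?_
      simp
  have h1 := norm_expPair_sub_le hW (b := 0) ha (by simpa using hR)
  rw [sub_zero] at h1
  have h2 : ‖expPair hW a‖ ≤ ‖expPair hW a - expPair hW 0‖ + ‖expPair hW (0 : NoiseSpace d H)‖ := by
    simpa using norm_add_le (expPair hW a - expPair hW 0) (expPair hW 0)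
  have h3 : ‖a‖ ≤ 1 + R := by nlinarith [sq_nonneg (‖a‖ - 1), norm_nonneg a]
  have h4 := Real.add_one_le_exp (R + 1)
  have h5 : (1 : ℝ) ≤ Real.exp (3 * R + 2) := Real.one_le_exp (by linarith)
  have h6 : Real.exp (4 * R + 3) = Real.exp (3 * R + 2) * Real.exp (R + 1) := by
    rw [← Real.exp_add]
    ring_nf
  rw [h6]
  nlinarith

end ExponentialFunctional

/-! ### The graph of the derivative as a subspace, and its closure. -/

section MalliavinGraph

variable {d : ℕ} {Ω : Type*} [MeasurableSpace Ω] {H : HurstIndex} {W : ℝ → Site d → Ω → ℝ}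
  {P : Measure Ω}

/-- The sum of two smooth random variables. -/
def SmoothData.add (S T : SmoothData d H) : SmoothData d H where
  n := S.n + T.n
  φ := Fin.append S.φ T.φ
  f v := S.f (fun i => v (Fin.castAdd T.n i)) + T.f (fun i => v (Fin.natAdd S.n i))
  growth := (S.growth.comp (ContinuousLinearMap.pi fun i : Fin S.n =>
      ContinuousLinearMap.proj (R := ℝ) (φ := fun _ => ℝ) (Fin.castAdd T.n i)).hasTemperateGrowth).add
    (T.growth.comp (ContinuousLinearMap.pi fun i : Fin T.n =>
      ContinuousLinearMap.proj (R := ℝ) (φ := fun _ => ℝ) (Fin.natAdd S.n i)).hasTemperateGrowth)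

lemma SmoothData.eval_add (hW : IsFBMField H W P) (S T : SmoothData d H) (ω : Ω) :
    (S.add T).eval hW ω = S.eval hW ω + T.eval hW ω := by
  simp [SmoothData.eval, SmoothData.add]

lemma SmoothData.differentiable (S : SmoothData d H) : Differentiable ℝ S.f :=
  S.growth.1.differentiable (by simp)

/-- `L₁` and `L₂` project onto the two blocks of coordinates; each kills the basis vectors of the
other block, so the chain rule splits the sum over the `S.n + T.n` coordinates. -/
lemma SmoothData.grad_add (hW : IsFBMField H W P) (S T : SmoothData d H) (ω : Ω) :
    (S.add T).grad hW ω = S.grad hW ω + T.grad hW ω := by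
  set L₁ : (Fin (S.n + T.n) → ℝ) →L[ℝ] (Fin S.n → ℝ) := ContinuousLinearMap.pi fun i : Fin S.n =>
      ContinuousLinearMap.proj (R := ℝ) (φ := fun _ => ℝ) (Fin.castAdd T.n i)
  set L₂ : (Fin (S.n + T.n) → ℝ) →L[ℝ] (Fin T.n → ℝ) := ContinuousLinearMap.pi fun i : Fin T.n =>
      ContinuousLinearMap.proj (R := ℝ) (φ := fun _ => ℝ) (Fin.natAdd S.n i)
  have hd : ∀ v, fderiv ℝ (fun v => S.f (L₁ v) + T.f (L₂ v)) v =
      (fderiv ℝ S.f (L₁ v)).comp L₁ + (fderiv ℝ T.f (L₂ v)).comp L₂ := fun v =>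
    (((S.differentiable (L₁ v)).hasFDerivAt.comp v L₁.hasFDerivAt).add
      ((T.differentiable (L₂ v)).hasFDerivAt.comp v L₂.hasFDerivAt)).fderiv
  have e1 : ∀ i, L₁ (Pi.single (Fin.castAdd T.n i) 1) = Pi.single i 1 := by
    intro i
    ext j
    simp [L₁, Pi.single_apply]
  have e2 : ∀ i, L₂ (Pi.single (Fin.castAdd T.n i) 1) = 0 := by
    intro i
    ext j
    have : Fin.natAdd S.n j ≠ Fin.castAdd T.n i := by
      intro h
      have := congrArg Fin.val h
      simp at this
      omega
    simp [L₂, this]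
  have e3 : ∀ i, L₁ (Pi.single (Fin.natAdd S.n i) 1) = 0 := by
    intro i
    ext j
    have : Fin.castAdd T.n j ≠ Fin.natAdd S.n i := by
      intro h
      have := congrArg Fin.val h
      simp at this
      omega
    simp [L₁, this]
  have e4 : ∀ i, L₂ (Pi.single (Fin.natAdd S.n i) 1) = Pi.single i 1 := by
    intro i
    ext j
    simp [L₂, Pi.single_apply]
  set v : Fin (S.n + T.n) → ℝ := fun j => noise hW (Fin.append S.φ T.φ j) ω
  have a1 : L₁ v = fun j => noise hW (S.φ j) ω := by
    ext j
    simp [L₁, v]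
  have a2 : L₂ v = fun j => noise hW (T.φ j) ω := by
    ext j
    simp [L₂, v]
  have hg : (S.add T).grad hW ω = ∑ i : Fin (S.n + T.n),
      fderiv ℝ (fun v => S.f (L₁ v) + T.f (L₂ v)) v (Pi.single i 1) • Fin.append S.φ T.φ i := rfl
  rw [hg, hd, Fin.sum_univ_add]
  simp only [add_apply, ContinuousLinearMap.comp_apply]
  simp only [e1, e2, e3, e4, a1, a2, map_zero, add_zero, zero_add, Fin.append_left,
    Fin.append_right]
  rfl

/-- A multiple of a smooth random variable. -/
def SmoothData.smul (c : ℝ) (S : SmoothData d H) : SmoothData d H where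
  n := S.n
  φ := S.φ
  f v := c * S.f v
  growth := (Function.HasTemperateGrowth.const c).mul S.growth

lemma SmoothData.eval_smul (hW : IsFBMField H W P) (c : ℝ) (S : SmoothData d H) (ω : Ω) :
    (S.smul c).eval hW ω = c * S.eval hW ω := rfl

lemma SmoothData.grad_smul (hW : IsFBMField H W P) (c : ℝ) (S : SmoothData d H) (ω : Ω) :
    (S.smul c).grad hW ω = c • S.grad hW ω := by
  unfold SmoothData.grad
  rw [Finset.smul_sum]
  refine Finset.sum_congr rfl fun i _ => ?_
  have hd : ∀ v, fderiv ℝ (S.smul c).f v = c • fderiv ℝ S.f v := fun v =>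
    fderiv_const_mul (S.differentiable v) c
  exact (congrArg (fun L : (Fin S.n → ℝ) →L[ℝ] ℝ => L (Pi.single i 1) • S.φ i) (hd _)).trans
    (smul_assoc c (fderiv ℝ S.f (fun j => noise hW (S.φ j) ω) (Pi.single i 1)) (S.φ i))

/-- The Taylor polynomial `∑_{k<m} 𝐖(φ)^k / k!` of `exp 𝐖(φ)`, as a smooth random variable. -/
def SmoothData.taylorExp (φ : NoiseSpace d H) (m : ℕ) : SmoothData d H where
  n := 1
  φ _ := φ
  f v := ∑ k ∈ Finset.range m, v 0 ^ k / (k.factorial : ℝ)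
  growth := by
    refine Function.HasTemperateGrowth.sum fun k _ => ?_
    have h : Function.HasTemperateGrowth fun v : Fin 1 → ℝ => v 0 :=
      (ContinuousLinearMap.proj (R := ℝ) (φ := fun _ : Fin 1 => ℝ) 0).hasTemperateGrowth
    simp only [div_eq_mul_inv]
    exact (h.pow k).mul (Function.HasTemperateGrowth.const _)

/-- Differentiation shortens the Taylor polynomial of `exp` by one term, hence `m + 1` on the left
and `m` on the right. -/
lemma SmoothData.grad_taylorExp (hW : IsFBMField H W P) (φ : NoiseSpace d H) (m : ℕ) (ω : Ω) :
    (taylorExp φ (m + 1)).grad hW ω =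
      (∑ k ∈ Finset.range m, noise hW φ ω ^ k / (k.factorial : ℝ)) • φ := by
  have hd : ∀ v : Fin 1 → ℝ, HasFDerivAt
      (fun v : Fin 1 → ℝ => ∑ k ∈ Finset.range (m + 1), v 0 ^ k / (k.factorial : ℝ))
      ((∑ k ∈ Finset.range m, v 0 ^ k / (k.factorial : ℝ)) •
        ContinuousLinearMap.proj (R := ℝ) (φ := fun _ : Fin 1 => ℝ) 0) v := by
    intro v
    have h0 : HasFDerivAt (fun v : Fin 1 → ℝ => v 0)
        (ContinuousLinearMap.proj (R := ℝ) (φ := fun _ : Fin 1 => ℝ) 0) v :=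
      (ContinuousLinearMap.proj (R := ℝ) (φ := fun _ : Fin 1 => ℝ) 0).hasFDerivAt
    have h1 : HasDerivAt (fun x : ℝ => ∑ k ∈ Finset.range (m + 1), x ^ k / (k.factorial : ℝ))
        (∑ k ∈ Finset.range m, v 0 ^ k / (k.factorial : ℝ)) (v 0) := by
      have h2 : HasDerivAt (fun x : ℝ => ∑ k ∈ Finset.range (m + 1), x ^ k / (k.factorial : ℝ))
          (∑ k ∈ Finset.range (m + 1), (k : ℝ) * v 0 ^ (k - 1) / (k.factorial : ℝ)) (v 0) :=
        HasDerivAt.fun_sum fun k _ => (hasDerivAt_pow k (v 0)).div_const _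
      convert h2 using 1
      rw [Finset.sum_range_succ']
      simp only [Nat.cast_zero, zero_mul, zero_div, add_zero, Nat.add_sub_cancel]
      refine Finset.sum_congr rfl fun k _ => ?_
      rw [Nat.factorial_succ]
      push_cast
      field_simp
    exact h1.comp_hasFDerivAt v h0
  unfold SmoothData.grad
  refine (Fin.sum_univ_one _).trans ?_
  refine (congrArg (fun L : (Fin 1 → ℝ) →L[ℝ] ℝ => L (Pi.single 0 1) • φ)
    (hd fun _ => noise hW φ ω).fderiv).trans ?_
  simp only [smul_apply, ContinuousLinearMap.proj_apply, Pi.single_eq_same, smul_eq_mul, mul_one]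

/-- The graph of the derivative on smooth random variables, in `L²(P) × L²(P; 𝓗)`. -/
def smoothGraph (hW : IsFBMField H W P) : Submodule ℝ (Lp ℝ 2 P × Lp (NoiseSpace d H) 2 P) where
  carrier := {p | ∃ S : SmoothData d H, p.1 =ᵐ[P] S.eval hW ∧ p.2 =ᵐ[P] S.grad hW}
  add_mem' := by
    rintro p q ⟨S, hS1, hS2⟩ ⟨T, hT1, hT2⟩
    refine ⟨S.add T, ?_, ?_⟩
    · filter_upwards [Lp.coeFn_add p.1 q.1, hS1, hT1] with ω h1 h2 h3
      rw [Prod.fst_add, h1, Pi.add_apply, h2, h3, SmoothData.eval_add]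
    · filter_upwards [Lp.coeFn_add p.2 q.2, hS2, hT2] with ω h1 h2 h3
      rw [Prod.snd_add, h1, Pi.add_apply, h2, h3, SmoothData.grad_add]
  zero_mem' := by
    refine ⟨⟨0, Fin.elim0, fun _ => 0, Function.HasTemperateGrowth.const 0⟩, ?_, ?_⟩
    · exact Lp.coeFn_zero ..
    · filter_upwards [Lp.coeFn_zero (NoiseSpace d H) 2 P] with ω h
      refine h.trans ?_
      simp [SmoothData.grad]
  smul_mem' := by
    rintro c p ⟨S, hS1, hS2⟩
    refine ⟨S.smul c, ?_, ?_⟩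
    · filter_upwards [Lp.coeFn_smul c p.1, hS1] with ω h1 h2
      rw [Prod.smul_fst, h1, Pi.smul_apply, h2, SmoothData.eval_smul, smul_eq_mul]
    · filter_upwards [Lp.coeFn_smul c p.2, hS2] with ω h1 h2
      rw [Prod.smul_snd, h1, Pi.smul_apply, h2, SmoothData.grad_smul]

/-- The distance on the product is the maximum of the two distances, so one approximating smooth
variable controls both components. `F` may be any version of the first component, as is needed for
fields defined pointwise in `ω`. -/
lemma hasMalliavinDeriv_of_mem_closure (hW : IsFBMField H W P)
    {p : Lp ℝ 2 P × Lp (NoiseSpace d H) 2 P} (hp : p ∈ (smoothGraph hW).topologicalClosure)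
    {F : Ω → ℝ} (hF : F =ᵐ[P] p.1) : HasMalliavinDeriv hW F p.2 := by
  refine ⟨(memLp_congr_ae hF).2 (Lp.memLp _), Lp.memLp _, fun δ hδ => ?_⟩
  obtain ⟨q, ⟨S, hS1, hS2⟩, hq⟩ := EMetric.mem_closure_iff.1 hp δ hδ
  refine ⟨S, ?_, ?_⟩
  · have h := (le_max_left _ _).trans hq.le
    rw [Lp.edist_def] at h
    refine le_trans (le_of_eq (eLpNorm_congr_ae ?_)) h
    filter_upwards [hF, hS1] with ω h1 h2
    rw [Pi.sub_apply, h1, h2]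
  · have h := (le_max_right _ _).trans hq.le
    rw [Lp.edist_def] at h
    refine le_trans (le_of_eq (eLpNorm_congr_ae ?_)) h
    filter_upwards [hS2] with ω h2
    rw [Pi.sub_apply, h2]

variable [IsProbabilityMeasure P]

lemma hasSum_pow_div_factorial_exp (x : ℝ) :
    HasSum (fun k : ℕ => x ^ k / (k.factorial : ℝ)) (Real.exp x) := by
  rw [Real.exp_eq_exp_ℝ]
  exact NormedSpace.expSeries_div_hasSum_exp x

lemma abs_taylor_le_exp_abs (x : ℝ) (m : ℕ) :
    |∑ k ∈ Finset.range m, x ^ k / (k.factorial : ℝ)| ≤ Real.exp |x| := by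
  refine le_trans ?_ (Real.sum_le_exp_of_nonneg (abs_nonneg x) m)
  refine (Finset.abs_sum_le_sum_abs _ _).trans (le_of_eq (Finset.sum_congr rfl fun k _ => ?_))
  rw [abs_div, abs_pow, Nat.abs_cast]

lemma exp_abs_sq_le (x : ℝ) : Real.exp |x| ^ 2 ≤ Real.exp (2 * x) + Real.exp (-2 * x) := by
  rw [← Real.exp_nat_mul]
  rcases abs_cases x with ⟨h, _⟩ | ⟨h, _⟩ <;> rw [h]
  · push_cast
    linarith [Real.exp_pos (-2 * x)]
  · have : ((2 : ℕ) : ℝ) * -x = -2 * x := by push_cast; ring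
    rw [this]
    linarith [Real.exp_pos (2 * x)]

lemma integrable_exp_abs_noise_sq (hW : IsFBMField H W P) (φ : NoiseSpace d H) :
    Integrable (fun ω => Real.exp |noise hW φ ω| ^ 2) P := by
  refine ((integrable_exp_noise hW φ 2).add (integrable_exp_noise hW φ (-2))).mono' ?_
    (ae_of_all _ fun ω => ?_)
  · exact (by fun_prop : Continuous fun x : ℝ => Real.exp |x| ^ 2).comp_aestronglyMeasurable
      (Lp.aestronglyMeasurable _)
  · rw [Real.norm_of_nonneg (by positivity)]
    exact exp_abs_sq_le _

lemma memLp_taylor_noise (hW : IsFBMField H W P) (φ : NoiseSpace d H) (m : ℕ) :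
    MemLp (fun ω => ∑ k ∈ Finset.range m, noise hW φ ω ^ k / (k.factorial : ℝ)) 2 P := by
  have hm : AEStronglyMeasurable
      (fun ω => ∑ k ∈ Finset.range m, noise hW φ ω ^ k / (k.factorial : ℝ)) P :=
    (by fun_prop : Continuous fun x : ℝ => ∑ k ∈ Finset.range m, x ^ k / (k.factorial : ℝ)
      ).comp_aestronglyMeasurable (Lp.aestronglyMeasurable _)
  rw [memLp_two_iff_integrable_sq hm]
  refine (integrable_exp_abs_noise_sq hW φ).mono' (hm.pow 2) (ae_of_all _ fun ω => ?_)
  rw [norm_pow]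
  gcongr
  exact abs_taylor_le_exp_abs _ _

/-- Dominated convergence: the Taylor polynomials and the exponential are all at most `exp |𝐖(φ)|`
in absolute value, which is square integrable. -/
lemma tendsto_taylor_noise (hW : IsFBMField H W P) (φ : NoiseSpace d H) :
    Tendsto (fun m => (memLp_taylor_noise hW φ m).toLp) atTop (𝓝 (expNoise hW φ)) := by
  refine tendsto_iff_norm_sub_tendsto_zero.2 ?_
  have e : ∀ m, ‖(memLp_taylor_noise hW φ m).toLp - expNoise hW φ‖ =
      √(∫ ω, (∑ k ∈ Finset.range m, noise hW φ ω ^ k / (k.factorial : ℝ) -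
        Real.exp (noise hW φ ω)) ^ 2 ∂P) := by
    intro m
    rw [expNoise, ← MemLp.toLp_sub, ← Real.sqrt_sq (norm_nonneg (MemLp.toLp _ _)),
      norm_toLp_two_sq]
    rfl
  simp only [e]
  rw [← Real.sqrt_zero]
  refine (Real.continuous_sqrt.tendsto 0).comp ?_
  have h0 : ∫ _ : Ω, (0 : ℝ) ∂P = 0 := by simp
  rw [← h0]
  refine tendsto_integral_of_dominated_convergence (fun ω => 4 * Real.exp |noise hW φ ω| ^ 2)
    (fun m => ?_) ((integrable_exp_abs_noise_sq hW φ).const_mul 4) (fun m => ae_of_all _ fun ω => ?_)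
    (ae_of_all _ fun ω => ?_)
  · exact (by fun_prop : Continuous fun x : ℝ =>
      (∑ k ∈ Finset.range m, x ^ k / (k.factorial : ℝ) - Real.exp x) ^ 2).comp_aestronglyMeasurable
      (Lp.aestronglyMeasurable _)
  · rw [norm_pow, Real.norm_eq_abs]
    have h1 := abs_taylor_le_exp_abs (noise hW φ ω) m
    have h2 : |Real.exp (noise hW φ ω)| ≤ Real.exp |noise hW φ ω| := by
      rw [Real.abs_exp]
      exact Real.exp_le_exp.2 (le_abs_self _)
    calc _ ≤ (2 * Real.exp |noise hW φ ω|) ^ 2 := by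
          gcongr
          refine (abs_sub _ _).trans ?_
          linarith
      _ = _ := by ring
  · have h := (hasSum_pow_div_factorial_exp (noise hW φ ω)).tendsto_sum_nat.sub_const
      (Real.exp (noise hW φ ω))
    have h' := h.pow 2
    simpa using h'

/-- `exp` lacks polynomial growth, so `exp 𝐖(φ)` is reached only as a limit of smooth variables; the
derivatives converge because they are again Taylor polynomials, times `φ`. -/
lemma expPair_mem_closure (hW : IsFBMField H W P) (φ : NoiseSpace d H) :
    expPair hW φ ∈ (smoothGraph hW).topologicalClosure := by
  have h1 : Tendsto (fun m => ((memLp_taylor_noise hW φ (m + 1)).toLp,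
      (ContinuousLinearMap.toSpanSingleton ℝ φ).compLp (memLp_taylor_noise hW φ m).toLp))
      atTop (𝓝 (expPair hW φ)) :=
    ((tendsto_add_atTop_iff_nat 1).2 (tendsto_taylor_noise hW φ)).prodMk_nhds
      ((((ContinuousLinearMap.toSpanSingleton ℝ φ).compLpL 2 P).continuous.tendsto _).comp
        (tendsto_taylor_noise hW φ))
  refine mem_closure_of_tendsto h1 (Eventually.of_forall fun m => ?_)
  refine ⟨SmoothData.taylorExp φ (m + 1), ?_, ?_⟩
  · exact (memLp_taylor_noise hW φ (m + 1)).coeFn_toLp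
  · filter_upwards [(ContinuousLinearMap.toSpanSingleton ℝ φ).coeFn_compLp
      (memLp_taylor_noise hW φ m).toLp, (memLp_taylor_noise hW φ m).coeFn_toLp] with ω e1 e2
    rw [SmoothData.grad_taylorExp]
    refine e1.trans ?_
    rw [e2]
    rfl

end MalliavinGraph

/-! ### Bochner integrals in `L²` versus pointwise integrals. -/

section BochnerIntegral

variable {Λ Ω : Type*} [MeasurableSpace Λ] [MeasurableSpace Ω] {μ : Measure Λ} {P : Measure Ω}
  [IsProbabilityMeasure P]

lemma integrable_uncurry_of_integrable_Lp {h : Λ → Lp ℝ 2 P} (hh : Integrable h μ)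
    {ψ : Λ → Ω → ℝ} (hψ : AEStronglyMeasurable (Function.uncurry ψ) (μ.prod P))
    (hhψ : ∀ᵐ l ∂μ, h l =ᵐ[P] ψ l) : Integrable (Function.uncurry ψ) (μ.prod P) := by
  rw [integrable_prod_iff hψ]
  constructor
  · filter_upwards [hhψ] with l hl
    exact ((Lp.memLp (h l)).integrable one_le_two).congr hl
  · refine hh.norm.mono' hψ.norm.integral_prod_right' ?_
    filter_upwards [hhψ] with l hl
    rw [Real.norm_of_nonneg (integral_nonneg fun _ => norm_nonneg _)]
    refine le_trans (le_of_eq (integral_congr_ae ?_)) (integral_norm_Lp_two_le (h l))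
    filter_upwards [hl] with ω hω
    rw [hω]
    rfl

variable [SFinite μ]

/-- The Bochner integral of `L²`-valued functions agrees with the pointwise integral. -/
lemma integral_Lp_ae_eq {h : Λ → Lp ℝ 2 P} (hh : Integrable h μ)
    {ψ : Λ → Ω → ℝ} (hψ : AEStronglyMeasurable (Function.uncurry ψ) (μ.prod P))
    (hhψ : ∀ᵐ l ∂μ, h l =ᵐ[P] ψ l) :
    (∫ l, h l ∂μ : Lp ℝ 2 P) =ᵐ[P] fun ω => ∫ l, ψ l ω ∂μ := by
  have hi := integrable_uncurry_of_integrable_Lp hh hψ hhψ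
  refine Integrable.ae_eq_of_forall_setIntegral_eq _ _ ((Lp.memLp _).integrable one_le_two)
    hi.integral_prod_right fun s hs _ => ?_
  have hi' : Integrable (Function.uncurry ψ) (μ.prod (P.restrict s)) := by
    have := Measure.prod_restrict (μ := μ) (ν := P) univ s
    rw [Measure.restrict_univ] at this
    rw [this]
    exact hi.restrict
  -- Integrating over `s` is pairing with the indicator of `s`, which commutes with the Bochner
  -- integral; on the pointwise side the same exchange is Fubini.
  rw [← L2.inner_indicatorConstLp_one hs (measure_ne_top P s), ← integral_inner hh,
    ← integral_integral_swap hi']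
  refine integral_congr_ae ?_
  filter_upwards [hhψ] with l hl
  rw [L2.inner_indicatorConstLp_one]
  exact integral_congr_ae (ae_restrict_of_ae hl)

end BochnerIntegral

/-! ### Mixtures of exponential functionals. -/

section IntegratedExponential

variable {d : ℕ} {Λ Ω : Type*} [MeasurableSpace Λ] [MeasurableSpace Ω] {H : HurstIndex}
  {W : ℝ → Site d → Ω → ℝ} {P : Measure Ω} [IsProbabilityMeasure P] {μ : Measure Λ}

lemma integrable_smul_expPair (hW : IsFBMField H W P) {Φ : Λ → NoiseSpace d H}
    (hΦ : AEStronglyMeasurable Φ μ) {c : Λ → ℝ} (hc : AEStronglyMeasurable c μ) {C : ℝ}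
    (hcC : ∀ l, |c l| ≤ C) {R : Λ → ℝ} (hR : ∀ᵐ l ∂μ, ‖Φ l‖ ^ 2 ≤ R l)
    (hRi : Integrable (fun l => Real.exp (4 * R l + 3)) μ) :
    Integrable (fun l => c l • expPair hW (Φ l)) μ := by
  refine (hRi.const_mul C).mono'
    (hc.smul ((continuous_expPair hW).comp_aestronglyMeasurable hΦ)) ?_
  filter_upwards [hR] with l hl
  rw [norm_smul]
  exact mul_le_mul (hcC l) (norm_expPair_le hW hl) (norm_nonneg _) ((abs_nonneg _).trans (hcC l))

variable [IsProbabilityMeasure μ]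

/-- A mean with respect to a probability measure of values in a closed convex set, here a closed
subspace, stays in that set. -/
lemma integral_smul_expPair_mem_closure (hW : IsFBMField H W P) {Φ : Λ → NoiseSpace d H}
    {c : Λ → ℝ} (hi : Integrable (fun l => c l • expPair hW (Φ l)) μ) :
    ∫ l, c l • expPair hW (Φ l) ∂μ ∈ (smoothGraph hW).topologicalClosure :=
  (Submodule.convex _).integral_mem (Submodule.isClosed_topologicalClosure _)
    (ae_of_all _ fun _ => Submodule.smul_mem _ _ (expPair_mem_closure hW _)) hi

/-- `noise hW (Φ l)` is only an almost-everywhere class for each `l`. A jointly measurable version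
`ψ` is therefore supplied, and Fubini gives both the absolute convergence for almost every `ω` and
the value of the integral. -/
lemma fst_integral_smul_expPair (hW : IsFBMField H W P) {Φ : Λ → NoiseSpace d H}
    {c : Λ → ℝ} (hi : Integrable (fun l => c l • expPair hW (Φ l)) μ) {ψ : Λ → Ω → ℝ}
    (hψ : AEStronglyMeasurable (Function.uncurry ψ) (μ.prod P))
    (hΦψ : ∀ᵐ l ∂μ, ψ l =ᵐ[P] fun ω => c l * Real.exp (noise hW (Φ l) ω)) :
    (∀ᵐ ω ∂P, Integrable (fun l => ψ l ω) μ) ∧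
      (fun ω => ∫ l, ψ l ω ∂μ) =ᵐ[P] (∫ l, c l • expPair hW (Φ l) ∂μ).1 := by
  have h1 : Integrable (fun l => (c l • expPair hW (Φ l)).1) μ := hi.fst
  have h2 : ∀ᵐ l ∂μ, ((c l • expPair hW (Φ l)).1 : Lp ℝ 2 P) =ᵐ[P] ψ l := by
    filter_upwards [hΦψ] with l hl
    filter_upwards [hl, coeFn_expNoise hW (Φ l), Lp.coeFn_smul (c l) (expNoise hW (Φ l))]
      with ω e1 e2 e3
    rw [e1, ← e2]
    exact e3
  refine ⟨(integrable_uncurry_of_integrable_Lp h1 hψ h2).prod_left_ae, ?_⟩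
  have e : (∫ l, c l • expPair hW (Φ l) ∂μ).1 = ∫ l, (c l • expPair hW (Φ l)).1 ∂μ :=
    ((ContinuousLinearMap.fst ℝ (Lp ℝ 2 P) (Lp (NoiseSpace d H) 2 P)).integral_comp_comm hi).symm
  rw [e]
  exact (integral_Lp_ae_eq h1 hψ h2).symm

end IntegratedExponential

/-! ### Correlations of increments and the bound linear in their number. -/

section Increments

variable {d : ℕ}

/-- The element `1_{[0,t]×{x}}` of `𝓗`. -/
def ind (H : HurstIndex) (t : ℝ) (x : Site d) : NoiseSpace d H :=
  ((stepInd H t x : StepFun d H) : NoiseSpace d H)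

lemma inner_ind_sub_ind (H : HurstIndex) (a b a' b' : ℝ) (x y : Site d) :
    inner ℝ (ind H b x - ind H a x) (ind H b' y - ind H a' y) =
      if x = y then (|b - a'| ^ (2 * (H : ℝ)) + |a - b'| ^ (2 * (H : ℝ))
        - |b - b'| ^ (2 * (H : ℝ)) - |a - a'| ^ (2 * (H : ℝ))) / 2 else 0 := by
  simp only [inner_sub_left, inner_sub_right, ind, inner_stepInd]
  split_ifs
  · simp only [fbmCov]
    ring
  · simp

lemma norm_ind_sub_ind_sq (H : HurstIndex) (a b : ℝ) (x : Site d) :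
    ‖ind H b x - ind H a x‖ ^ 2 = |b - a| ^ (2 * (H : ℝ)) := by
  have h2H : (2 * (H : ℝ)) ≠ 0 := by linarith [H.2.1]
  rw [← real_inner_self_eq_norm_sq, inner_ind_sub_ind, if_pos rfl, sub_self, sub_self, abs_zero,
    Real.zero_rpow h2H, abs_sub_comm a b]
  ring

lemma norm_ind_sub_ind (H : HurstIndex) (a b : ℝ) (x : Site d) :
    ‖ind H b x - ind H a x‖ = |b - a| ^ (H : ℝ) := by
  rw [← sq_eq_sq₀ (norm_nonneg _) (by positivity), norm_ind_sub_ind_sq, ← Real.rpow_natCast,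
    ← Real.rpow_mul (abs_nonneg _), mul_comm]
  norm_num

lemma continuous_ind (H : HurstIndex) (x : Site d) : Continuous fun t => ind H t x := by
  refine continuous_iff_continuousAt.2 fun a => tendsto_iff_norm_sub_tendsto_zero.2 ?_
  simp only [norm_ind_sub_ind]
  have h : Continuous fun t : ℝ => |t - a| ^ (H : ℝ) :=
    (by fun_prop : Continuous fun t : ℝ => |t - a|).rpow_const fun _ => Or.inr H.2.1.le
  simpa [Real.zero_rpow H.2.1.ne'] using h.tendsto a

/-- `p + u` and `p + v` are convex combinations of `p` and `p + u + v` with exchanged weights;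
adding the two convexity inequalities makes the weights sum to one. -/
lemma _root_.ConvexOn.add_le_add_of_nonneg {f : ℝ → ℝ} (hf : ConvexOn ℝ (Ici 0) f) {p u v : ℝ}
    (hp : 0 ≤ p) (hu : 0 ≤ u) (hv : 0 ≤ v) : f (p + u) + f (p + v) ≤ f p + f (p + u + v) := by
  rcases eq_or_lt_of_le (add_nonneg hu hv) with h | h
  · have hu0 : u = 0 := by linarith
    have hv0 : v = 0 := by linarith
    simp [hu0, hv0]
  have hp' : p ∈ Ici (0 : ℝ) := hp
  have hq' : p + u + v ∈ Ici (0 : ℝ) := by simp only [mem_Ici]; positivity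
  have h1 := hf.2 hp' hq' (div_nonneg hv h.le) (div_nonneg hu h.le) (by field_simp; ring)
  have h2 := hf.2 hp' hq' (div_nonneg hu h.le) (div_nonneg hv h.le) (by field_simp)
  simp only [smul_eq_mul] at h1 h2
  have e1 : v / (u + v) * p + u / (u + v) * (p + u + v) = p + u := by field_simp; ring
  have e2 : u / (u + v) * p + v / (u + v) * (p + u + v) = p + v := by field_simp; ring
  have e3 : v / (u + v) + u / (u + v) = 1 := by field_simp; ring
  rw [e1] at h1
  rw [e2] at h2
  have e4 : f p + f (p + u + v) =
      (v / (u + v) + u / (u + v)) * (f p + f (p + u + v)) := by rw [e3, one_mul]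
  rw [e4]
  linarith

/-- Increments of the same fractional Brownian motion over disjoint intervals are positively
correlated if `H ≥ 1/2`. -/
lemma inner_increments_nonneg (H : HurstIndex) (hH : 1 ≤ 2 * (H : ℝ)) {a b a' b' : ℝ} (h1 : a ≤ b)
    (h2 : b ≤ a') (h3 : a' ≤ b') (x : Site d) :
    0 ≤ inner ℝ (ind H b x - ind H a x) (ind H b' x - ind H a' x) := by
  -- Here `p = a' - b` is the gap and `u = b - a`, `v = b' - a'` are the lengths; the covariance is
  -- half the resulting second difference of `r ↦ r^{2H}`, convex for `2H ≥ 1`.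
  have h := (convexOn_rpow hH).add_le_add_of_nonneg (sub_nonneg.2 h2) (sub_nonneg.2 h1)
    (sub_nonneg.2 h3)
  rw [inner_ind_sub_ind, if_pos rfl, abs_sub_comm b a', abs_sub_comm a b', abs_sub_comm b b',
    abs_sub_comm a a', abs_of_nonneg (by linarith : 0 ≤ a' - b),
    abs_of_nonneg (by linarith : 0 ≤ b' - a), abs_of_nonneg (by linarith : 0 ≤ b' - b),
    abs_of_nonneg (by linarith : 0 ≤ a' - a)]
  ring_nf at h ⊢
  linarith

/-- Increments of the same fractional Brownian motion over disjoint intervals are negatively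
correlated if `H ≤ 1/2`. -/
lemma inner_increments_nonpos (H : HurstIndex) (hH : 2 * (H : ℝ) ≤ 1) {a b a' b' : ℝ} (h1 : a ≤ b)
    (h2 : b ≤ a') (h3 : a' ≤ b') (x : Site d) :
    inner ℝ (ind H b x - ind H a x) (ind H b' x - ind H a' x) ≤ 0 := by
  have h := (Real.concaveOn_rpow (by linarith [H.2.1]) hH).neg.add_le_add_of_nonneg
    (sub_nonneg.2 h2) (sub_nonneg.2 h1) (sub_nonneg.2 h3)
  rw [inner_ind_sub_ind, if_pos rfl, abs_sub_comm b a', abs_sub_comm a b', abs_sub_comm b b',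
    abs_sub_comm a a', abs_of_nonneg (by linarith : 0 ≤ a' - b),
    abs_of_nonneg (by linarith : 0 ≤ b' - a), abs_of_nonneg (by linarith : 0 ≤ b' - b),
    abs_of_nonneg (by linarith : 0 ≤ a' - a)]
  simp only [Pi.neg_apply] at h
  ring_nf at h ⊢
  linarith

/-- The squared norm is expanded into all pairwise correlations, whose sign is governed by `H`. The
growth linear in `n` is what makes exponentials of the bound integrable over the walk. -/
lemma norm_sum_increments_sq_le (H : HurstIndex) {c : ℕ → ℝ} (hc : Antitone c) (y : ℕ → Site d)
    (n : ℕ) : ‖∑ k ∈ Finset.range n, (ind H (c k) (y k) - ind H (c (k + 1)) (y k))‖ ^ 2 ≤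
      n * (c 0 - c n) ^ (2 * (H : ℝ)) := by
  have h2H : 0 ≤ 2 * (H : ℝ) := by linarith [H.2.1]
  rw [← real_inner_self_eq_norm_sq, sum_inner]
  simp only [inner_sum]
  rcases le_total (2 * (H : ℝ)) 1 with hH | hH
  -- Off-diagonal terms are zero at different sites and nonpositive at equal sites, so only the `n`
  -- variances remain.
  · have key : ∀ j k, inner ℝ (ind H (c j) (y j) - ind H (c (j + 1)) (y j))
        (ind H (c k) (y k) - ind H (c (k + 1)) (y k)) ≤
        if j = k then (c j - c (j + 1)) ^ (2 * (H : ℝ)) else 0 := by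
      intro j k
      by_cases hjk : j = k
      · subst hjk
        rw [if_pos rfl, real_inner_self_eq_norm_sq, norm_ind_sub_ind_sq,
          abs_of_nonneg (sub_nonneg.2 (hc (Nat.le_succ j)))]
      rw [if_neg hjk]
      by_cases hy : y j = y k
      · rw [hy]
        rcases lt_or_gt_of_ne hjk with h | h
        · rw [real_inner_comm]
          exact inner_increments_nonpos H hH (hc (Nat.le_succ k)) (hc h) (hc (Nat.le_succ j)) _
        · exact inner_increments_nonpos H hH (hc (Nat.le_succ j)) (hc h) (hc (Nat.le_succ k)) _
      · rw [inner_ind_sub_ind, if_neg hy]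
    calc _ ≤ ∑ j ∈ Finset.range n, ∑ k ∈ Finset.range n,
          (if j = k then (c j - c (j + 1)) ^ (2 * (H : ℝ)) else 0) :=
        Finset.sum_le_sum fun j _ => Finset.sum_le_sum fun k _ => key j k
      _ = ∑ j ∈ Finset.range n, (c j - c (j + 1)) ^ (2 * (H : ℝ)) := by
        refine Finset.sum_congr rfl fun j hj => ?_
        rw [Finset.sum_ite_eq, if_pos hj]
      _ ≤ ∑ j ∈ Finset.range n, (c 0 - c n) ^ (2 * (H : ℝ)) := by
        refine Finset.sum_le_sum fun j hj => ?_
        have e1 : c j ≤ c 0 := hc (Nat.zero_le j)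
        have e2 : c n ≤ c (j + 1) := hc (Finset.mem_range.1 hj)
        have e3 : c (j + 1) ≤ c j := hc (Nat.le_succ j)
        exact Real.rpow_le_rpow (by linarith) (by linarith) h2H
      _ = _ := by simp
  · rcases Nat.eq_zero_or_pos n with rfl | hn
    · simp
    -- Moving all increments to the single site `0` replaces zero correlations by nonnegative ones;
    -- at one site the sum telescopes.
    have key : ∀ j k, inner ℝ (ind H (c j) (y j) - ind H (c (j + 1)) (y j))
        (ind H (c k) (y k) - ind H (c (k + 1)) (y k)) ≤
        inner ℝ (ind H (c j) (0 : Site d) - ind H (c (j + 1)) 0)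
          (ind H (c k) 0 - ind H (c (k + 1)) 0) := by
      intro j k
      by_cases hy : y j = y k
      · rw [inner_ind_sub_ind, inner_ind_sub_ind, if_pos hy, if_pos rfl]
      rw [inner_ind_sub_ind, if_neg hy]
      rcases lt_trichotomy j k with h | rfl | h
      · rw [real_inner_comm]
        exact inner_increments_nonneg H hH (hc (Nat.le_succ k)) (hc h) (hc (Nat.le_succ j)) _
      · exact real_inner_self_nonneg
      · exact inner_increments_nonneg H hH (hc (Nat.le_succ j)) (hc h) (hc (Nat.le_succ k)) _
    calc _ ≤ ∑ j ∈ Finset.range n, ∑ k ∈ Finset.range n,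
          inner ℝ (ind H (c j) (0 : Site d) - ind H (c (j + 1)) 0)
            (ind H (c k) 0 - ind H (c (k + 1)) 0) :=
        Finset.sum_le_sum fun j _ => Finset.sum_le_sum fun k _ => key j k
      _ = ‖∑ j ∈ Finset.range n, (ind H (c j) (0 : Site d) - ind H (c (j + 1)) 0)‖ ^ 2 := by
        rw [← real_inner_self_eq_norm_sq, sum_inner]
        simp only [inner_sum]
      _ = (c 0 - c n) ^ (2 * (H : ℝ)) := by
        rw [Finset.sum_range_sub' (fun j => ind H (c j) (0 : Site d)), norm_ind_sub_ind_sq,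
          abs_of_nonneg (sub_nonneg.2 (hc (Nat.zero_le n)))]
      _ ≤ _ := by
        refine le_mul_of_one_le_left (Real.rpow_nonneg (sub_nonneg.2 (hc (Nat.zero_le n))) _) ?_
        exact_mod_cast hn

end Increments

/-! ### Sums of increments along a path, and mollification in time. -/

section PathSums

variable {d : ℕ} {E F : Type*} [NormedAddCommGroup E] [NormedSpace ℝ E]
  [NormedAddCommGroup F] [NormedSpace ℝ F]

/-- The sum of increments of `e` along a path of the walk which defines `walkIntegral`, for fields
with values in a vector space. -/
def walkSum (e : ℝ → Site d → E) (x : Site d) (τ : ℕ → ℝ) (ξ : ℕ → Site d) (t : ℝ) : E :=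
  ∑ k ∈ Finset.range (jumpCount τ t + 1),
    (e (t - jumpTime τ k) (skeleton x ξ k) - e (t - min (jumpTime τ (k + 1)) t) (skeleton x ξ k))

lemma norm_walkSum_sub_le {E : Type*} [NormedAddCommGroup E] {e e' : ℝ → Site d → E} {δ : ℝ} (h : ∀ s y, ‖e s y - e' s y‖ ≤ δ)
    (x : Site d) (τ : ℕ → ℝ) (ξ : ℕ → Site d) (t : ℝ) :
    ‖walkSum e x τ ξ t - walkSum e' x τ ξ t‖ ≤ (jumpCount τ t + 1) * (2 * δ) := by
  rw [walkSum, walkSum, ← Finset.sum_sub_distrib]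
  refine (norm_sum_le_of_le _ fun k _ => ?_ : _ ≤ ∑ k ∈ Finset.range (jumpCount τ t + 1), 2 * δ).trans
    (by simp)
  rw [sub_sub_sub_comm]
  refine (norm_sub_le _ _).trans ?_
  rw [two_mul]
  exact add_le_add (h _ _) (h _ _)

lemma map_walkSum (L : E →L[ℝ] F) (e : ℝ → Site d → E) (x : Site d) (τ : ℕ → ℝ)
    (ξ : ℕ → Site d) (t : ℝ) :
    L (walkSum e x τ ξ t) = walkSum (fun s y => L (e s y)) x τ ξ t := by
  simp [walkSum, map_sum, map_sub]

/-- The average `(2ε)⁻¹ ∫_{-ε}^ε e(t+v,x) dv`. -/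
def mollify (ε : ℝ) (e : ℝ → Site d → E) (t : ℝ) (y : Site d) : E :=
  (2 * ε)⁻¹ • ∫ v in (-ε)..ε, e (t + v) y

/-- As an average of sums for time-shifted fields, the mollified sum inherits any norm bound
invariant under time shifts, with the same constant for every `ε`. -/
lemma walkSum_mollify {e : ℝ → Site d → E} (he : ∀ y, Continuous fun t => e t y) (ε : ℝ)
    (x : Site d) (τ : ℕ → ℝ) (ξ : ℕ → Site d) (t : ℝ) :
    walkSum (mollify ε e) x τ ξ t =
      (2 * ε)⁻¹ • ∫ v in (-ε)..ε, walkSum (fun s y => e (s + v) y) x τ ξ t := by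
  have hi : ∀ s y, IntervalIntegrable (fun v => e (s + v) y) volume (-ε) ε := fun s y =>
    ((he y).comp (continuous_const.add continuous_id)).intervalIntegrable _ _
  simp only [walkSum, mollify]
  rw [intervalIntegral.integral_finsetSum fun k _ => (hi _ _).sub (hi _ _), Finset.smul_sum]
  refine Finset.sum_congr rfl fun k _ => ?_
  rw [intervalIntegral.integral_sub (hi _ _) (hi _ _), smul_sub]

lemma norm_average_le {ε : ℝ} (hε : 0 < ε) {f : ℝ → E} {C : ℝ}
    (hf : ∀ v, |v| ≤ ε → ‖f v‖ ≤ C) : ‖(2 * ε)⁻¹ • ∫ v in (-ε)..ε, f v‖ ≤ C := by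
  have h := intervalIntegral.norm_integral_le_of_norm_le_const (a := -ε) (b := ε) (f := f) (C := C)
    fun v hv => by
      rw [uIoc_of_le (by linarith)] at hv
      exact hf v (abs_le.2 ⟨hv.1.le, hv.2⟩)
  rw [norm_smul, norm_inv, Real.norm_of_nonneg (by positivity : 0 ≤ 2 * ε)]
  rw [abs_of_nonneg (by linarith : 0 ≤ ε - -ε)] at h
  calc _ ≤ (2 * ε)⁻¹ * (C * (ε - -ε)) := by gcongr
    _ = C := by field_simp; ring

lemma mollify_sub_self [CompleteSpace E] {e : ℝ → Site d → E} (he : ∀ y, Continuous fun t => e t y)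
    {ε : ℝ} (hε : 0 < ε) (t : ℝ) (y : Site d) :
    mollify ε e t y - e t y = (2 * ε)⁻¹ • ∫ v in (-ε)..ε, (e (t + v) y - e t y) := by
  have hi : IntervalIntegrable (fun v => e (t + v) y) volume (-ε) ε :=
    ((he y).comp (continuous_const.add continuous_id)).intervalIntegrable _ _
  rw [intervalIntegral.integral_sub hi intervalIntegrable_const, intervalIntegral.integral_const, smul_sub, smul_smul]
  have : (2 * ε)⁻¹ * (ε - -ε) = 1 := by field_simp; ring
  rw [this, one_smul]
  rfl

lemma continuous_mollify {e : ℝ → Site d → E} (he : ∀ y, Continuous fun t => e t y) (ε : ℝ)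
    (y : Site d) : Continuous fun t => mollify ε e t y := by
  refine Continuous.const_smul ?_ _
  exact intervalIntegral.continuous_parametric_intervalIntegral_of_continuous'
    (f := fun t v => e (t + v) y) ((he y).comp (continuous_fst.add continuous_snd)) _ _

lemma norm_mollify_ind_sub_le {H : HurstIndex} {ε : ℝ} (hε : 0 < ε) (t : ℝ) (y : Site d) :
    ‖mollify ε (ind H) t y - ind H t y‖ ≤ ε ^ (H : ℝ) := by
  rw [mollify_sub_self (continuous_ind H) hε]
  refine norm_average_le hε fun v hv => ?_
  rw [norm_ind_sub_ind, add_sub_cancel_left]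
  exact Real.rpow_le_rpow (abs_nonneg _) hv H.2.1.le

end PathSums

/-! ### Deterministic analysis of a path with finitely many jumps. -/

section GoodPaths

variable {d : ℕ}

/-- The holding times are nonnegative and there are finitely many jumps before time `T`. -/
structure IsGoodPath (T : ℝ) (τ : ℕ → ℝ) : Prop where
  nonneg : ∀ n, 0 ≤ τ n
  finite : {n : ℕ | jumpTime τ (n + 1) ≤ T}.Finite

variable {T : ℝ} {τ : ℕ → ℝ}

lemma IsGoodPath.monotone (h : IsGoodPath T τ) : Monotone (jumpTime τ) :=
  monotone_nat_of_le_succ fun n => by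
    rw [jumpTime, jumpTime, Finset.sum_range_succ]
    linarith [h.nonneg n]

lemma jumpTime_zero (τ : ℕ → ℝ) : jumpTime τ 0 = 0 := by simp [jumpTime]

lemma IsGoodPath.mono (h : IsGoodPath T τ) {t : ℝ} (ht : t ≤ T) : IsGoodPath t τ :=
  ⟨h.nonneg, h.finite.subset fun _ hn => le_trans hn ht⟩

/-- Since jump times increase, the indices counted by `jumpCount` form an initial segment.
Finiteness matters: `ncard` of an infinite set is `0`. -/
lemma IsGoodPath.lt_jumpCount_iff (h : IsGoodPath T τ) (n : ℕ) :
    n < jumpCount τ T ↔ jumpTime τ (n + 1) ≤ T := by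
  have hex : ∃ m, ¬ jumpTime τ (m + 1) ≤ T := by
    obtain ⟨m, hm⟩ := h.finite.exists_notMem
    exact ⟨m, hm⟩
  classical
  have hset : {n : ℕ | jumpTime τ (n + 1) ≤ T} = ↑(Finset.range (Nat.find hex)) := by
    ext k
    simp only [mem_ofPred_eq, Finset.coe_range, mem_Iio]
    constructor
    · intro hk
      by_contra hlt
      exact Nat.find_spec hex (le_trans (h.monotone (by omega)) hk)
    · intro hk
      exact not_not.1 (Nat.find_min hex hk)
  have hN : jumpCount τ T = Nat.find hex := by
    rw [jumpCount, hset, Set.ncard_coe_finset, Finset.card_range]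
  rw [hN]
  have := congrArg (n ∈ ·) hset
  simp only [mem_ofPred_eq, Finset.coe_range, mem_Iio, eq_iff_iff] at this
  exact this.symm

lemma IsGoodPath.jumpCount_le (h : IsGoodPath T τ) {t : ℝ} (ht : t ≤ T) :
    jumpCount τ t ≤ jumpCount τ T := by
  by_contra! hlt
  exact lt_irrefl _ ((h.lt_jumpCount_iff _).2 ((((h.mono ht).lt_jumpCount_iff _).1 hlt).trans ht))

lemma IsGoodPath.jumpTime_le (h : IsGoodPath T τ) (hT : 0 ≤ T) {k : ℕ} (hk : k ≤ jumpCount τ T) :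
    jumpTime τ k ≤ T := by
  rcases k with _ | k
  · rwa [jumpTime_zero]
  · exact (h.lt_jumpCount_iff k).1 hk

lemma IsGoodPath.lt_jumpTime (h : IsGoodPath T τ) : T < jumpTime τ (jumpCount τ T + 1) := by
  by_contra! hle
  exact lt_irrefl _ ((h.lt_jumpCount_iff _).2 hle)

/-- The jump times in reversed time, `t - min(S_k, t)`. -/
def reversedTime (τ : ℕ → ℝ) (t : ℝ) (k : ℕ) : ℝ := t - min (jumpTime τ k) t

lemma IsGoodPath.antitone_reversedTime (h : IsGoodPath T τ) : Antitone (reversedTime τ T) :=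
  fun _ _ hij => sub_le_sub_left (min_le_min_right _ (h.monotone hij)) _

lemma reversedTime_zero (τ : ℕ → ℝ) (hT : 0 ≤ T) : reversedTime τ T 0 = T := by
  simp [reversedTime, jumpTime_zero, hT]

lemma IsGoodPath.reversedTime_last (h : IsGoodPath T τ) :
    reversedTime τ T (jumpCount τ T + 1) = 0 := by
  rw [reversedTime, min_eq_right h.lt_jumpTime.le, sub_self]

/-- For `k ≤ N` the jump time is at most `T`, so truncation is harmless and the increments lie over
consecutive intervals of one partition of `[0,T]`. -/
lemma IsGoodPath.walkSum_eq {E : Type*} [NormedAddCommGroup E] (h : IsGoodPath T τ)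
    (hT : 0 ≤ T) (e : ℝ → Site d → E) (x : Site d) (ξ : ℕ → Site d) :
    walkSum e x τ ξ T = ∑ k ∈ Finset.range (jumpCount τ T + 1),
      (e (reversedTime τ T k) (skeleton x ξ k) - e (reversedTime τ T (k + 1)) (skeleton x ξ k)) := by
  refine Finset.sum_congr rfl fun k hk => ?_
  rw [reversedTime, reversedTime,
    min_eq_left (h.jumpTime_le hT (Nat.lt_succ_iff.1 (Finset.mem_range.1 hk)))]

lemma IsGoodPath.norm_walkSum_ind_sq_le (h : IsGoodPath T τ) (hT : 0 ≤ T) (H : HurstIndex)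
    (x : Site d) (ξ : ℕ → Site d) (v : ℝ) :
    ‖walkSum (fun s y => ind H (s + v) y) x τ ξ T‖ ^ 2 ≤
      (jumpCount τ T + 1) * T ^ (2 * (H : ℝ)) := by
  rw [h.walkSum_eq hT]
  have := norm_sum_increments_sq_le H (c := fun k => reversedTime τ T k + v)
    (fun i j hij => add_le_add_left (h.antitone_reversedTime hij) v) (skeleton x ξ)
    (jumpCount τ T + 1)
  refine this.trans (le_of_eq ?_)
  rw [reversedTime_zero τ hT, h.reversedTime_last]
  push_cast
  ring_nf

lemma IsGoodPath.norm_walkSum_mollify_sq_le (h : IsGoodPath T τ) (hT : 0 ≤ T) (H : HurstIndex)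
    (x : Site d) (ξ : ℕ → Site d) {ε : ℝ} (hε : 0 < ε) :
    ‖walkSum (mollify ε (ind H)) x τ ξ T‖ ^ 2 ≤ (jumpCount τ T + 1) * T ^ (2 * (H : ℝ)) := by
  rw [walkSum_mollify (continuous_ind H), ← Real.le_sqrt (norm_nonneg _) (by positivity)]
  exact norm_average_le hε fun v _ =>
    Real.le_sqrt_of_sq_le (h.norm_walkSum_ind_sq_le hT H x ξ v)

/-- Both sides are the same combination of a primitive of `w(·,y)` at the four points `a ± ε`, `b ±
ε`. -/
lemma integral_smoothedDeriv {w : ℝ → Site d → ℝ} (hw : ∀ y, Continuous fun t => w t y) (ε : ℝ)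
    (a b : ℝ) (y : Site d) :
    ∫ s in a..b, smoothedDeriv w ε s y = mollify ε w b y - mollify ε w a y := by
  have hF : ∀ p q, ∫ t in p..q, w t y = (∫ t in (0 : ℝ)..q, w t y) - ∫ t in (0 : ℝ)..p, w t y :=
    fun p q => (intervalIntegral.integral_interval_sub_left ((hw y).intervalIntegrable _ _)
      ((hw y).intervalIntegrable _ _)).symm
  have h1 : IntervalIntegrable (fun s => w (s + ε) y) volume a b :=
    ((hw y).comp (continuous_id.add continuous_const)).intervalIntegrable _ _
  have h2 : IntervalIntegrable (fun s => w (s - ε) y) volume a b :=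
    ((hw y).comp (continuous_id.sub continuous_const)).intervalIntegrable _ _
  simp only [smoothedDeriv, mollify, intervalIntegral.integral_div, smul_eq_mul]
  rw [intervalIntegral.integral_sub h1 h2,
    intervalIntegral.integral_comp_add_right (fun t => w t y),
    intervalIntegral.integral_comp_sub_right (fun t => w t y),
    intervalIntegral.integral_comp_add_left (fun t => w t y),
    intervalIntegral.integral_comp_add_left (fun t => w t y),
    hF (a + ε), hF (a - ε), hF (b + -ε), hF (a + -ε), ← sub_eq_add_neg, ← sub_eq_add_neg]
  ring

lemma IsGoodPath.walk_eq_skeleton (h : IsGoodPath T τ) (x : Site d) (ξ : ℕ → Site d)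
    {k : ℕ} {s : ℝ} (hs : s ∈ Ioo (reversedTime τ T (k + 1)) (reversedTime τ T k)) :
    walk x τ ξ (T - s) = skeleton x ξ k := by
  have h1 : jumpTime τ k ≤ T - s := by
    have := hs.2
    rw [reversedTime] at this
    rcases min_cases (jumpTime τ k) T with ⟨e, _⟩ | ⟨e, _⟩
    · linarith
    -- If the truncation at `T` is active at index `k`, the interval containing `s` is empty.
    · have h0 := hs.1
      rw [reversedTime] at h0
      linarith [min_le_right (jumpTime τ (k + 1)) T]
  have h2 : T - s < jumpTime τ (k + 1) := by
    have := hs.1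
    rw [reversedTime] at this
    linarith [min_le_left (jumpTime τ (k + 1)) T]
  have hs0 : T - s ≤ T := by
    have := hs.1
    rw [reversedTime] at this
    linarith [min_le_right (jumpTime τ (k + 1)) T]
  have hg := h.mono hs0
  rw [walk]
  congr 1
  refine le_antisymm ?_ ?_
  · by_contra! hlt
    exact absurd ((hg.lt_jumpCount_iff k).1 hlt) (not_le.2 h2)
  · rcases k with _ | k
    · exact Nat.zero_le _
    · exact (hg.lt_jumpCount_iff k).2 h1

/-- The integral of the smoothed noise along the walk is the sum of the increments of the
mollified noise. -/
lemma IsGoodPath.integral_smoothedDeriv_walk (h : IsGoodPath T τ) (hT : 0 ≤ T)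
    {w : ℝ → Site d → ℝ} (hw : ∀ y, Continuous fun t => w t y) (ε : ℝ) (x : Site d)
    (ξ : ℕ → Site d) :
    ∫ s in (0 : ℝ)..T, smoothedDeriv w ε s (walk x τ ξ (T - s)) =
      walkSum (mollify ε w) x τ ξ T := by
  have hcont : ∀ y, Continuous fun s => smoothedDeriv w ε s y := fun y =>
    (((hw y).comp (continuous_id.add continuous_const)).sub
      ((hw y).comp (continuous_id.sub continuous_const))).div_const _
  have hEq : ∀ k, EqOn (fun s => smoothedDeriv w ε s (walk x τ ξ (T - s)))
      (fun s => smoothedDeriv w ε s (skeleton x ξ k))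
      (Ioo (reversedTime τ T (k + 1)) (reversedTime τ T k)) := by
    intro k s hs
    simp only [h.walk_eq_skeleton x ξ hs]
  have hle : ∀ k, reversedTime τ T (k + 1) ≤ reversedTime τ T k := fun k =>
    h.antitone_reversedTime (Nat.le_succ k)
  have hae : ∀ k, ∀ᵐ s, s ∈ uIoc (reversedTime τ T (k + 1)) (reversedTime τ T k) →
      smoothedDeriv w ε s (walk x τ ξ (T - s)) = smoothedDeriv w ε s (skeleton x ξ k) := by
    intro k
    have hne : ∀ᵐ s : ℝ, s ≠ reversedTime τ T k := by
      simp [ae_iff]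
    filter_upwards [hne] with s hs hmem
    rw [uIoc_of_le (hle k)] at hmem
    exact hEq k ⟨hmem.1, lt_of_le_of_ne hmem.2 hs⟩
  have hint : ∀ k, IntervalIntegrable (fun s => smoothedDeriv w ε s (walk x τ ξ (T - s))) volume
      (reversedTime τ T k) (reversedTime τ T (k + 1)) := by
    intro k
    refine IntervalIntegrable.symm ?_
    refine ((hcont (skeleton x ξ k)).intervalIntegrable _ _).congr_ae ?_
    rw [EventuallyEq, ae_restrict_iff' measurableSet_uIoc]
    filter_upwards [hae k] with s hs hmem
    exact (hs hmem).symm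
  have hsum := intervalIntegral.sum_integral_adjacent_intervals
    (n := jumpCount τ T + 1) (fun k _ => hint k)
  -- The reversed jump times run downwards from `T` to `0`, hence the change of orientation below.
  rw [reversedTime_zero τ hT, h.reversedTime_last] at hsum
  rw [intervalIntegral.integral_symm, ← hsum, h.walkSum_eq hT, ← Finset.sum_neg_distrib]
  refine Finset.sum_congr rfl fun k _ => ?_
  rw [← intervalIntegral.integral_symm, intervalIntegral.integral_congr_ae (hae k),
    integral_smoothedDeriv hw]

lemma IsGoodPath.fkWeightSmoothed_eq (h : IsGoodPath T τ) (hT : 0 ≤ T) (u₀ : Site d → ℝ)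
    {w : ℝ → Site d → ℝ} (hw : ∀ y, Continuous fun t => w t y) (ε : ℝ) (x : Site d)
    (ξ : ℕ → Site d) :
    fkWeightSmoothed u₀ w ε x T τ ξ = fkWeight u₀ (mollify ε w) x T τ ξ := by
  rw [fkWeightSmoothed, h.integral_smoothedDeriv_walk hT hw]
  rfl

end GoodPaths

/-! ### Measurability in the holding times, the steps and the noise. -/

section Measurability

variable {d : ℕ}

@[fun_prop]
lemma measurable_jumpTime (n : ℕ) : Measurable fun τ : ℕ → ℝ => jumpTime τ n :=
  Finset.measurable_sum _ fun i _ => measurable_pi_apply i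

-- The count is recovered from a countable sum of indicators. For infinitely many jumps both sides
-- vanish, as `ncard` and `toReal` both send the infinite value to `0`.
@[fun_prop]
lemma measurable_jumpCount (t : ℝ) : Measurable fun τ : ℕ → ℝ => jumpCount τ t := by
  have e : (fun τ : ℕ → ℝ => jumpCount τ t) = fun τ =>
      ⌊(∑' n : ℕ, {τ : ℕ → ℝ | jumpTime τ (n + 1) ≤ t}.indicator (fun _ => (1 : ℝ≥0∞)) τ).toReal⌋₊ := by
    funext τ
    have h1 : ∑' n : ℕ, {τ : ℕ → ℝ | jumpTime τ (n + 1) ≤ t}.indicator (fun _ => (1 : ℝ≥0∞)) τ =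
        ({n : ℕ | jumpTime τ (n + 1) ≤ t}.encard : ℝ≥0∞) := by
      rw [← ENNReal.tsum_set_one, tsum_subtype _ fun _ => (1 : ℝ≥0∞)]
      rfl
    rw [h1, jumpCount, Set.ncard]
    rcases eq_or_ne {n : ℕ | jumpTime τ (n + 1) ≤ t}.encard ⊤ with h | h
    · simp [h]
    · obtain ⟨m, hm⟩ := ENat.ne_top_iff_exists.1 h
      simp [← hm]
  rw [e]
  refine Nat.measurable_floor.comp (Measurable.ennreal_toReal (Measurable.tsum fun n => ?_))
  exact measurable_const.indicator (measurableSet_le (measurable_jumpTime _) measurable_const)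

@[fun_prop]
lemma measurable_skeleton (x : Site d) (n : ℕ) : Measurable fun ξ : ℕ → Site d => skeleton x ξ n :=
  measurable_const.add (Finset.measurable_sum _ fun i _ => measurable_pi_apply i)

lemma measurable_walk (x : Site d) (t : ℝ) :
    Measurable fun l : (ℕ → ℝ) × (ℕ → Site d) => walk x l.1 l.2 t := by
  have h : Measurable fun p : ℕ × (ℕ → Site d) => skeleton x p.2 p.1 :=
    measurable_from_prod_countable_right fun n => measurable_skeleton x n
  exact h.comp (((measurable_jumpCount t).comp measurable_fst).prodMk measurable_snd)

/-- A sum of random length is the pointwise limit of fixed-length sums with indicators. Strong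
measurability is used because the target, later `𝓗`, is not assumed separable. -/
lemma stronglyMeasurable_sum_range {α E : Type*} [MeasurableSpace α] [NormedAddCommGroup E]
    {N : α → ℕ} (hN : Measurable N) {f : ℕ → α → E} (hf : ∀ k, StronglyMeasurable (f k)) :
    StronglyMeasurable fun a => ∑ k ∈ Finset.range (N a), f k a := by
  refine stronglyMeasurable_of_tendsto atTop (f := fun m a =>
    ∑ k ∈ Finset.range m, {a | k < N a}.indicator (f k) a) (fun m => ?_) ?_
  · refine Finset.stronglyMeasurable_fun_sum _ fun k _ => (hf k).indicator ?_
    exact measurableSet_lt measurable_const hN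
  · rw [tendsto_pi_nhds]
    intro a
    refine tendsto_const_nhds.congr' ?_
    filter_upwards [eventually_ge_atTop (N a)] with m hm
    rw [← Finset.sum_subset (Finset.range_mono hm)]
    · refine Finset.sum_congr rfl fun k hk => ?_
      rw [indicator_of_mem]
      exact Finset.mem_range.1 hk
    · intro k _ hk
      rw [indicator_of_notMem]
      exact fun h => hk (Finset.mem_range.2 h)

lemma stronglyMeasurable_walkSum {α E : Type*} [MeasurableSpace α] [NormedAddCommGroup E]
    {e : α → ℝ → Site d → E}
    (he : StronglyMeasurable fun p : α × ℝ × Site d => e p.1 p.2.1 p.2.2) (x : Site d) (t : ℝ) :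
    StronglyMeasurable fun p : ((ℕ → ℝ) × (ℕ → Site d)) × α =>
      walkSum (e p.2) x p.1.1 p.1.2 t := by
  refine stronglyMeasurable_sum_range
    (f := fun k (p : ((ℕ → ℝ) × (ℕ → Site d)) × α) =>
      e p.2 (t - jumpTime p.1.1 k) (skeleton x p.1.2 k) -
        e p.2 (t - min (jumpTime p.1.1 (k + 1)) t) (skeleton x p.1.2 k)) ?_ fun k => ?_
  · exact (((measurable_jumpCount t).comp (measurable_fst.comp measurable_fst))).add_const 1
  · have hs : Measurable fun p : ((ℕ → ℝ) × (ℕ → Site d)) × α => skeleton x p.1.2 k :=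
      (measurable_skeleton x k).comp (measurable_snd.comp measurable_fst)
    have hj : ∀ k, Measurable fun p : ((ℕ → ℝ) × (ℕ → Site d)) × α => jumpTime p.1.1 k :=
      fun k => (measurable_jumpTime k).comp (measurable_fst.comp measurable_fst)
    refine StronglyMeasurable.sub ?_ ?_
    · exact he.comp_measurable (measurable_snd.prodMk ((measurable_const.sub (hj k)).prodMk hs))
    · exact he.comp_measurable (measurable_snd.prodMk
        ((measurable_const.sub ((hj (k + 1)).min measurable_const)).prodMk hs))

lemma stronglyMeasurable_walkSum_of_continuous {E : Type*} [NormedAddCommGroup E]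
    {e : ℝ → Site d → E} (he : ∀ y, Continuous fun t => e t y) (x : Site d) (t : ℝ) :
    StronglyMeasurable fun l : (ℕ → ℝ) × (ℕ → Site d) => walkSum e x l.1 l.2 t := by
  have hc : Continuous fun p : ℝ × Site d => e p.1 p.2 := continuous_prod_of_discrete_right.2 he
  have hm : StronglyMeasurable fun p : ℝ × Site d => e p.1 p.2 := hc.stronglyMeasurable
  have hm' : StronglyMeasurable fun p : Unit × ℝ × Site d => e p.2.1 p.2.2 :=
    hm.comp_measurable measurable_snd
  have h := stronglyMeasurable_walkSum (α := Unit) (e := fun _ => e) hm' x t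
  exact h.comp_measurable (g := fun l : (ℕ → ℝ) × (ℕ → Site d) => (l, ()))
    (measurable_id.prodMk measurable_const)

end Measurability

/-! ### Continuous versions of Gaussian fields indexed by elements of `𝓗`. -/

section NoiseFields

variable {d : ℕ} {Ω : Type*} [MeasurableSpace Ω] {H : HurstIndex} {W : ℝ → Site d → Ω → ℝ}
  {P : Measure Ω}

/-- The field `w`, with continuous sample paths, is a version of `𝐖(e(t,x))`. -/
structure IsNoiseField (hW : IsFBMField H W P) (e : ℝ → Site d → NoiseSpace d H)
    (w : ℝ → Site d → Ω → ℝ) : Prop where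
  continuous_elem : ∀ y, Continuous fun t => e t y
  continuous_paths : ∀ y ω, Continuous fun t => w t y ω
  measurable : ∀ t y, Measurable (w t y)
  ae_eq : ∀ t y, noise hW (e t y) =ᵐ[P] w t y

lemma isNoiseField_ind (hW : IsFBMField H W P) : IsNoiseField hW (ind H) W where
  continuous_elem := continuous_ind H
  continuous_paths := hW.continuous_paths
  measurable := hW.measurable
  ae_eq t y := by
    rw [ind, noise_stepInd]
    exact (hW.memLp (t, y)).coeFn_toLp

variable {hW : IsFBMField H W P} {e : ℝ → Site d → NoiseSpace d H} {w : ℝ → Site d → Ω → ℝ}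

lemma IsNoiseField.measurable_uncurry (h : IsNoiseField hW e w) (y : Site d) :
    Measurable fun p : ℝ × Ω => w p.1 y p.2 :=
  measurable_uncurry_of_continuous_of_measurable (u := fun t ω => w t y ω)
    (fun ω => h.continuous_paths y ω) fun t => h.measurable t y

lemma IsNoiseField.stronglyMeasurable (h : IsNoiseField hW e w) :
    StronglyMeasurable fun p : Ω × ℝ × Site d => w p.2.1 p.2.2 p.1 := by
  have h1 : Measurable fun p : Site d × ℝ × Ω => w p.2.1 p.1 p.2.2 :=
    measurable_from_prod_countable_right fun y => h.measurable_uncurry y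
  refine (h1.comp (f := fun p : Ω × ℝ × Site d => (p.2.2, p.2.1, p.1)) ?_).stronglyMeasurable
  fun_prop

lemma IsNoiseField.walkSum_ae_eq (h : IsNoiseField hW e w) (x : Site d) (τ : ℕ → ℝ)
    (ξ : ℕ → Site d) (t : ℝ) :
    noise hW (walkSum e x τ ξ t) =ᵐ[P] fun ω => walkSum (fun s y => w s y ω) x τ ξ t := by
  rw [map_walkSum]
  refine (Lp.coeFn_finsetSum _ _).trans ?_
  have h2 : ∀ᵐ ω ∂P, ∀ k ∈ Finset.range (jumpCount τ t + 1),
      (noise hW (e (t - jumpTime τ k) (skeleton x ξ k)) -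
        noise hW (e (t - min (jumpTime τ (k + 1)) t) (skeleton x ξ k)) : Lp ℝ 2 P) ω =
      w (t - jumpTime τ k) (skeleton x ξ k) ω -
        w (t - min (jumpTime τ (k + 1)) t) (skeleton x ξ k) ω := by
    rw [Filter.eventually_all_finset]
    intro k _
    filter_upwards [Lp.coeFn_sub (noise hW (e (t - jumpTime τ k) (skeleton x ξ k)))
        (noise hW (e (t - min (jumpTime τ (k + 1)) t) (skeleton x ξ k))),
      h.ae_eq (t - jumpTime τ k) (skeleton x ξ k),
      h.ae_eq (t - min (jumpTime τ (k + 1)) t) (skeleton x ξ k)] with ω e1 e2 e3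
    rw [e1, Pi.sub_apply, e2, e3]
  filter_upwards [h2] with ω hω
  rw [Finset.sum_apply]
  exact Finset.sum_congr rfl hω

/-- `𝐖` is continuous and linear, so it commutes with averaging in `𝓗`; the resulting Bochner
integral in `L²` is then the pathwise average. This lets `u` and `u_ε` be treated by the same
lemmas. -/
lemma IsNoiseField.mollify [IsProbabilityMeasure P] (h : IsNoiseField hW e w) {ε : ℝ}
    (hε : 0 < ε) :
    IsNoiseField hW (mollify ε e) fun t y ω => mollify ε (fun s z => w s z ω) t y where
  continuous_elem := continuous_mollify h.continuous_elem ε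
  continuous_paths y ω := continuous_mollify (fun y => h.continuous_paths y ω) ε y
  measurable t y := by
    simp only [FractionalPAM.mollify, intervalIntegral.integral_of_le (by linarith : -ε ≤ ε)]
    have hm : Measurable fun p : Ω × ℝ => w (t + p.2) y p.1 :=
      (h.measurable_uncurry y).comp (by fun_prop : Measurable fun p : Ω × ℝ => (t + p.2, p.1))
    exact hm.stronglyMeasurable.integral_prod_right'.measurable.const_smul (2 * ε)⁻¹
  ae_eq t y := by
    have hle : -ε ≤ ε := by linarith
    have hc : Continuous fun v => e (t + v) y :=
      (h.continuous_elem y).comp (continuous_const.add continuous_id)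
    have hint : Integrable (fun v => noise hW (e (t + v) y)) (volume.restrict (Ioc (-ε) ε)) :=
      (((noise hW).continuous.comp hc).integrableOn_Icc).mono_set Ioc_subset_Icc_self
    have h1 : noise hW (FractionalPAM.mollify ε e t y) =
        (2 * ε)⁻¹ • ∫ v in Ioc (-ε) ε, noise hW (e (t + v) y) := by
      rw [FractionalPAM.mollify, map_smul, intervalIntegral.integral_of_le hle,
        ContinuousLinearMap.integral_comp_comm]
      exact hc.integrableOn_Icc.mono_set Ioc_subset_Icc_self
    have hm : Measurable fun p : ℝ × Ω => w (t + p.1) y p.2 :=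
      (h.measurable_uncurry y).comp (by fun_prop : Measurable fun p : ℝ × Ω => (t + p.1, p.2))
    have h2 := integral_Lp_ae_eq hint (ψ := fun v ω => w (t + v) y ω)
      hm.aestronglyMeasurable (ae_of_all _ fun v => h.ae_eq (t + v) y)
    rw [h1]
    filter_upwards [Lp.coeFn_smul ((2 * ε)⁻¹) (∫ v in Ioc (-ε) ε, noise hW (e (t + v) y)), h2]
      with ω e1 e2
    rw [e1, Pi.smul_apply, e2, FractionalPAM.mollify, intervalIntegral.integral_of_le hle]

end NoiseFields

/-! ### Exponential moments of the number of jumps. -/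

section JumpCountMoments

variable {d : ℕ} {Ω' : Type*} [MeasurableSpace Ω'] {Q : Measure Ω'} {κ : ℝ}
  {τ : ℕ → Ω' → ℝ} {ξ : ℕ → Ω' → Site d}

lemma ae_pos_expMeasure (hκ : 0 < κ) : ∀ᵐ y ∂(expMeasure κ), 0 < y := by
  have := isProbabilityMeasure_expMeasure hκ
  have h : (expMeasure κ).real (Iic 0) = 0 := by
    rw [← cdf_eq_real, cdf_expMeasure_eq hκ]
    simp
  rw [ae_iff]
  simp only [not_lt]
  exact (measureReal_eq_zero_iff (measure_ne_top _ _)).1 h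

/-- The Laplace transform of an almost surely positive variable tends to `0` at infinity, by
dominated convergence. -/
lemma exists_integral_exp_neg_mul_le (hκ : 0 < κ) {δ : ℝ} (hδ : 0 < δ) :
    ∃ r : ℝ, 0 ≤ r ∧ ∫ y, Real.exp (-r * y) ∂(expMeasure κ) ≤ δ := by
  have := isProbabilityMeasure_expMeasure hκ
  have h : Tendsto (fun n : ℕ => ∫ y, Real.exp (-(n : ℝ) * y) ∂(expMeasure κ)) atTop
      (𝓝 (∫ _, (0 : ℝ) ∂(expMeasure κ))) := by
    refine tendsto_integral_of_dominated_convergence (fun _ => 1) (fun n => ?_)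
      (integrable_const 1) (fun n => ?_) ?_
    · exact (by fun_prop : Continuous fun y : ℝ => Real.exp (-(n : ℝ) * y)).aestronglyMeasurable
    · filter_upwards [ae_pos_expMeasure hκ] with y hy
      rw [Real.norm_of_nonneg (Real.exp_nonneg _), Real.exp_le_one_iff]
      have : 0 ≤ (n : ℝ) * y := by positivity
      linarith
    · filter_upwards [ae_pos_expMeasure hκ] with y hy
      refine Real.tendsto_exp_atBot.comp ?_
      simp only [neg_mul]
      exact tendsto_neg_atTop_atBot.comp (tendsto_natCast_atTop_atTop.atTop_mul_const hy)
  rw [integral_zero] at h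
  obtain ⟨n, hn⟩ := (h.eventually_le_const hδ).exists
  exact ⟨n, Nat.cast_nonneg n, hn⟩

lemma ae_pos_holding (hκ : 0 < κ) (hX : IsSimpleWalkData κ τ ξ Q) :
    ∀ᵐ ω' ∂Q, ∀ n, 0 < τ n ω' := by
  rw [ae_all_iff]
  exact fun n => ((hX.holding_law n).ae_iff (p := fun y => 0 < y) (by fun_prop)).2
    (ae_pos_expMeasure hκ)

/-- The law of the sequences of holding times and steps. -/
def pathLaw (τ : ℕ → Ω' → ℝ) (ξ : ℕ → Ω' → Site d) (Q : Measure Ω') :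
    Measure ((ℕ → ℝ) × (ℕ → Site d)) :=
  Q.map fun ω' => (fun n => τ n ω', fun n => ξ n ω')

lemma aemeasurable_path (hX : IsSimpleWalkData κ τ ξ Q) :
    AEMeasurable (fun ω' => (fun n => τ n ω', fun n => ξ n ω')) Q :=
  (aemeasurable_pi_lambda _ fun n => (hX.holding_law n).aemeasurable).prodMk
    (aemeasurable_pi_lambda _ fun n => (hX.step_law n).aemeasurable)

variable [IsProbabilityMeasure Q]

/-- The probability of `n` jumps before time `T` decays faster than any geometric sequence. -/
lemma measureReal_jumpTime_le (hκ : 0 < κ) (hX : IsSimpleWalkData κ τ ξ Q) (T : ℝ) {δ : ℝ}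
    (hδ : 0 < δ) : ∃ C : ℝ, ∀ n, Q.real {ω' | jumpTime (fun k => τ k ω') n ≤ T} ≤ C * δ ^ n := by
  obtain ⟨r, hr, hrδ⟩ := exists_integral_exp_neg_mul_le hκ hδ
  refine ⟨Real.exp (r * T), fun n => ?_⟩
  have hm : ∀ k, AEMeasurable (τ k) Q := fun k => (hX.holding_law k).aemeasurable
  have hS : (fun ω' => jumpTime (fun k => τ k ω') n) = ∑ k ∈ Finset.range n, τ k := by
    funext ω'
    simp [jumpTime]
  have hmS : AEMeasurable (fun ω' => jumpTime (fun k => τ k ω') n) Q := by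
    rw [hS]
    exact Finset.aemeasurable_sum _ fun k _ => hm k
  have hint : Integrable (fun ω' => Real.exp (-r * jumpTime (fun k => τ k ω') n)) Q := by
    refine Integrable.of_bound (C := 1) (hmS.const_mul (-r)).exp.aestronglyMeasurable ?_
    filter_upwards [ae_pos_holding hκ hX] with ω' h
    rw [Real.norm_of_nonneg (Real.exp_nonneg _), Real.exp_le_one_iff]
    have : 0 ≤ r * jumpTime (fun k => τ k ω') n :=
      mul_nonneg hr (Finset.sum_nonneg fun k _ => (h k).le)
    linarith
  -- Chernoff bound at parameter `-r`: independence gives `e^{rT}` times the `n`-th power of a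
  -- Laplace transform that is at most `δ`.
  refine (measure_le_le_exp_mul_mgf (X := fun ω' => jumpTime (fun k => τ k ω') n) T
    (by linarith : -r ≤ 0) hint).trans ?_
  rw [neg_neg, hS, hX.holding_indep.mgf_sum₀ hm]
  refine mul_le_mul_of_nonneg_left ?_ (Real.exp_nonneg _)
  refine (Finset.prod_le_prod (g := fun _ => δ) (fun k _ => mgf_nonneg) fun k _ => ?_).trans (by simp)
  refine le_trans (le_of_eq ?_) hrδ
  rw [mgf, ← (hX.holding_law k).map_eq, integral_map (hm k)]
  exact (by fun_prop : Continuous fun y : ℝ => Real.exp (-r * y)).aestronglyMeasurable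

lemma isProbabilityMeasure_pathLaw (hX : IsSimpleWalkData κ τ ξ Q) :
    IsProbabilityMeasure (pathLaw τ ξ Q) :=
  Measure.isProbabilityMeasure_map (aemeasurable_path hX)

/-- This one bound serves twice: `c = 0` shows that almost surely only finitely many jumps occur
before `T`, and general `c` bounds the exponential moments of their number. -/
lemma lintegral_tsum_exp_lt_top (hκ : 0 < κ) (hX : IsSimpleWalkData κ τ ξ Q) (T c : ℝ) :
    ∫⁻ l, ∑' n : ℕ, {l : (ℕ → ℝ) × (ℕ → Site d) | jumpTime l.1 n ≤ T}.indicator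
      (fun _ => ENNReal.ofReal (Real.exp (c * n))) l ∂(pathLaw τ ξ Q) ≠ ∞ := by
  -- This `δ` turns `e^{cn} δ^n` into `2^{-n}`.
  obtain ⟨C, hC⟩ := measureReal_jumpTime_le hκ hX T (δ := Real.exp (-c) / 2) (by positivity)
  have hs : ∀ n, MeasurableSet {l : (ℕ → ℝ) × (ℕ → Site d) | jumpTime l.1 n ≤ T} := fun n =>
    measurableSet_le ((measurable_jumpTime n).comp measurable_fst) measurable_const
  rw [lintegral_tsum fun n => (measurable_const.indicator (hs n)).aemeasurable]
  have hsum : Summable fun n : ℕ => C * (1 / 2 : ℝ) ^ n := summable_geometric_two.mul_left C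
  refine ne_top_of_le_ne_top hsum.tsum_ofReal_ne_top (ENNReal.tsum_le_tsum fun n => ?_)
  rw [lintegral_indicator_const (hs n), pathLaw, Measure.map_apply_of_aemeasurable
    (aemeasurable_path hX) (hs n), ← ofReal_measureReal, ← ENNReal.ofReal_mul (Real.exp_nonneg _)]
  refine ENNReal.ofReal_le_ofReal ?_
  calc _ ≤ Real.exp (c * n) * (C * (Real.exp (-c) / 2) ^ n) :=
        mul_le_mul_of_nonneg_left (hC n) (Real.exp_nonneg _)
    _ = C * (1 / 2) ^ n := by
        rw [div_pow, ← Real.exp_nat_mul, one_div, inv_pow]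
        have : Real.exp (c * n) * Real.exp (n * -c) = 1 := by
          rw [← Real.exp_add]
          ring_nf
          exact Real.exp_zero
        linear_combination (C * (2 ^ n)⁻¹) * this

lemma ae_pathLaw_isGoodPath (hκ : 0 < κ) (hX : IsSimpleWalkData κ τ ξ Q) (T : ℝ) :
    ∀ᵐ l ∂(pathLaw τ ξ Q), IsGoodPath T l.1 := by
  have hpos : ∀ᵐ l ∂(pathLaw τ ξ Q), ∀ n, 0 < l.1 n := by
    refine (ae_map_iff (aemeasurable_path hX) ?_).2 (ae_pos_holding hκ hX)
    simp only [ofPred_forall]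
    exact MeasurableSet.iInter fun n => measurableSet_lt measurable_const
      ((measurable_pi_apply n).comp measurable_fst)
  have hfin := ae_lt_top' (Measurable.aemeasurable ?_) (lintegral_tsum_exp_lt_top hκ hX T 0)
  · filter_upwards [hpos, hfin] with l h1 h2
    refine ⟨fun n => (h1 n).le, ?_⟩
    have h3 := ENNReal.finite_const_le_of_tsum_ne_top h2.ne one_ne_zero
    refine (h3.preimage (Set.injOn_of_injective (add_left_injective 1))).subset fun n hn => ?_
    simp only [zero_mul, Real.exp_zero, ENNReal.ofReal_one, mem_preimage, mem_ofPred_eq]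
    rw [indicator_of_mem]
    exact hn
  · exact Measurable.tsum fun n => measurable_const.indicator
      (measurableSet_le ((measurable_jumpTime n).comp measurable_fst) measurable_const)

lemma ae_isGoodPath (hκ : 0 < κ) (hX : IsSimpleWalkData κ τ ξ Q) (T : ℝ) :
    ∀ᵐ ω' ∂Q, IsGoodPath T fun n => τ n ω' :=
  ae_of_ae_map (aemeasurable_path hX) (ae_pathLaw_isGoodPath hκ hX T)

/-- The number of jumps has exponential moments of all orders. -/
lemma integrable_exp_jumpCount (hκ : 0 < κ) (hX : IsSimpleWalkData κ τ ξ Q) {T : ℝ} (hT : 0 ≤ T)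
    (a b : ℝ) : Integrable (fun l => Real.exp (a * jumpCount l.1 T + b)) (pathLaw τ ξ Q) := by
  simp only [Real.exp_add]
  refine Integrable.mul_const ⟨?_, ?_⟩ _
  · have hm : Measurable fun l : (ℕ → ℝ) × (ℕ → Site d) => (jumpCount l.1 T : ℝ) :=
      measurable_from_nat.comp ((measurable_jumpCount T).comp measurable_fst)
    exact (hm.const_mul a).exp.aestronglyMeasurable
  · refine lt_of_le_of_lt (lintegral_mono_ae ?_) (lintegral_tsum_exp_lt_top hκ hX T a).lt_top
    filter_upwards [ae_pathLaw_isGoodPath hκ hX T] with l hl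
    -- The term with index `N` is present in the series because the `N`-th jump occurs by time `T`.
    refine le_trans (le_of_eq ?_) (ENNReal.le_tsum (jumpCount l.1 T))
    rw [indicator_of_mem, Real.enorm_of_nonneg (Real.exp_nonneg _)]
    exact hl.jumpTime_le hT le_rfl

end JumpCountMoments

/-! ### The Feynman–Kac fields as integrals in `L²(P) × L²(P; 𝓗)`. -/

section FeynmanKac

variable {d : ℕ} {Ω Ω' : Type*} [MeasurableSpace Ω] [MeasurableSpace Ω'] {H : HurstIndex}
  {W : ℝ → Site d → Ω → ℝ} {P : Measure Ω} {Q : Measure Ω'} {κ : ℝ}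
  {τ : ℕ → Ω' → ℝ} {ξ : ℕ → Ω' → Site d} {hW : IsFBMField H W P}
  {e : ℝ → Site d → NoiseSpace d H} {w : ℝ → Site d → Ω → ℝ}

lemma IsNoiseField.measurable_fkWeight (h : IsNoiseField hW e w) (u₀ : Site d → ℝ) (x : Site d)
    (s : ℝ) : Measurable fun p : ((ℕ → ℝ) × (ℕ → Site d)) × Ω =>
      fkWeight u₀ (fun r y => w r y p.2) x s p.1.1 p.1.2 := by
  have h1 : Measurable fun p : ((ℕ → ℝ) × (ℕ → Site d)) × Ω => u₀ (walk x p.1.1 p.1.2 s) :=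
    (Measurable.of_discrete (f := u₀)).comp ((measurable_walk x s).comp measurable_fst)
  have h2 := (stronglyMeasurable_walkSum (e := fun ω r y => w r y ω) h.stronglyMeasurable x
    s).measurable
  exact h1.mul h2.exp

lemma IsNoiseField.fkWeight_ae_eq (h : IsNoiseField hW e w) (u₀ : Site d → ℝ) (x : Site d) (s : ℝ)
    (l : (ℕ → ℝ) × (ℕ → Site d)) :
    (fun ω => fkWeight u₀ (fun r y => w r y ω) x s l.1 l.2) =ᵐ[P] fun ω =>
      u₀ (walk x l.1 l.2 s) * Real.exp (noise hW (walkSum e x l.1 l.2 s) ω) := by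
  filter_upwards [h.walkSum_ae_eq x l.1 l.2 s] with ω hω
  rw [hω]
  rfl

lemma lintegral_enorm_sq_eq_of_ae_eq {E : Type*} [NormedAddCommGroup E] (f : Lp E 2 P) {F : Ω → E}
    (hF : F =ᵐ[P] f) : ∫⁻ ω, ‖F ω‖ₑ ^ 2 ∂P = ‖f‖ₑ ^ 2 := by
  rw [Lp.enorm_def]
  have h := eLpNorm_nnreal_pow_eq_lintegral (μ := P) (f := f) (p := 2) (by norm_num)
  simp only [NNReal.coe_ofNat, ENNReal.rpow_ofNat, ENNReal.coe_ofNat] at h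
  rw [h]
  refine lintegral_congr_ae ?_
  filter_upwards [hF] with ω hω
  rw [hω]

variable [IsProbabilityMeasure Q] {u₀ : Site d → ℝ} {C T s : ℝ}

lemma ae_fkWeightSmoothed_eq (hW : IsFBMField H W P) (hκ : 0 < κ) (hX : IsSimpleWalkData κ τ ξ Q)
    (u₀ : Site d → ℝ) (hs : 0 ≤ s) (x : Site d) (ε : ℝ) (ω : Ω) :
    (fun ω' => fkWeightSmoothed u₀ (fun r y => W r y ω) ε x s (fun n => τ n ω') fun n => ξ n ω')
      =ᵐ[Q] fun ω' => fkWeight u₀ (mollify ε fun r y => W r y ω) x s (fun n => τ n ω')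
        fun n => ξ n ω' := by
  filter_upwards [ae_isGoodPath hκ hX s] with ω' h
  exact h.fkWeightSmoothed_eq hs u₀ (fun y => hW.continuous_paths y ω) ε x _

variable [IsProbabilityMeasure P]

/-- The Feynman--Kac field and its derivative, as an integral over the paths of the walk with
values in `L²(P) × L²(P; 𝓗)`. -/
def fkPair (hW : IsFBMField H W P) (u₀ : Site d → ℝ) (τ : ℕ → Ω' → ℝ) (ξ : ℕ → Ω' → Site d)
    (Q : Measure Ω') (e : ℝ → Site d → NoiseSpace d H) (s : ℝ) (x : Site d) :
    Lp ℝ 2 P × Lp (NoiseSpace d H) 2 P :=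
  ∫ l, u₀ (walk x l.1 l.2 s) • expPair hW (walkSum e x l.1 l.2 s) ∂(pathLaw τ ξ Q)

lemma integrable_fkPair (hκ : 0 < κ) (hX : IsSimpleWalkData κ τ ξ Q) (hu₀ : ∀ y, |u₀ y| ≤ C)
    (hT : 0 ≤ T) (he : ∀ y, Continuous fun t => e t y) (x : Site d) {D : ℝ}
    (hD : ∀ᵐ l ∂(pathLaw τ ξ Q), ‖walkSum e x l.1 l.2 s‖ ^ 2 ≤ (jumpCount l.1 T + 1) * D) :
    Integrable (fun l => u₀ (walk x l.1 l.2 s) • expPair hW (walkSum e x l.1 l.2 s))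
      (pathLaw τ ξ Q) := by
  refine integrable_smul_expPair hW
    (stronglyMeasurable_walkSum_of_continuous he x s).aestronglyMeasurable
    ((Measurable.of_discrete (f := u₀)).comp (measurable_walk x s)).aestronglyMeasurable
    (fun _ => hu₀ _) hD ?_
  refine (integrable_exp_jumpCount hκ hX hT (4 * D) (4 * D + 3)).congr (ae_of_all _ fun l => ?_)
  ring_nf

/-- Stated for a general noise field, so that it covers `W` itself and its mollification, the latter
yielding `u_ε`. -/
lemma integrable_fkWeight_and_fk_ae_eq (hX : IsSimpleWalkData κ τ ξ Q) (h : IsNoiseField hW e w)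
    {x : Site d} (hi : Integrable (fun l => u₀ (walk x l.1 l.2 s) •
      expPair hW (walkSum e x l.1 l.2 s)) (pathLaw τ ξ Q)) :
    (∀ᵐ ω ∂P, Integrable (fun ω' =>
      fkWeight u₀ (fun r y => w r y ω) x s (fun n => τ n ω') (fun n => ξ n ω')) Q) ∧
    fk u₀ w τ ξ Q s x =ᵐ[P] (fkPair hW u₀ τ ξ Q e s x).1 := by
  have := isProbabilityMeasure_pathLaw hX
  obtain ⟨h1, h2⟩ := fst_integral_smul_expPair hW hi
    (ψ := fun l ω => fkWeight u₀ (fun r y => w r y ω) x s l.1 l.2)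
    (h.measurable_fkWeight u₀ x s).aestronglyMeasurable
    (ae_of_all _ fun l => h.fkWeight_ae_eq u₀ x s l)
  refine ⟨h1.mono fun ω hω => hω.comp_aemeasurable (aemeasurable_path hX), ?_⟩
  refine EventuallyEq.trans (ae_of_all _ fun ω => ?_) h2
  refine (integral_map (f := fun l : (ℕ → ℝ) × (ℕ → Site d) =>
    fkWeight u₀ (fun r y => w r y ω) x s l.1 l.2) (aemeasurable_path hX) ?_).symm
  exact ((h.measurable_fkWeight u₀ x s).comp
    (measurable_id.prodMk measurable_const)).aestronglyMeasurable

lemma fkPair_mem_closure (hX : IsSimpleWalkData κ τ ξ Q) {x : Site d}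
    (hi : Integrable (fun l => u₀ (walk x l.1 l.2 s) • expPair hW (walkSum e x l.1 l.2 s))
      (pathLaw τ ξ Q)) :
    fkPair hW u₀ τ ξ Q e s x ∈ (smoothGraph hW).topologicalClosure := by
  have := isProbabilityMeasure_pathLaw hX
  exact integral_smul_expPair_mem_closure hW hi

lemma ae_norm_walkSum_ind_sq_le (hκ : 0 < κ) (hX : IsSimpleWalkData κ τ ξ Q)
    (hs : s ∈ Icc 0 T) (H : HurstIndex) (x : Site d) : ∀ᵐ l ∂(pathLaw τ ξ Q),
      ‖walkSum (ind H) x l.1 l.2 s‖ ^ 2 ≤ (jumpCount l.1 T + 1) * T ^ (2 * (H : ℝ)) := by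
  filter_upwards [ae_pathLaw_isGoodPath hκ hX T] with l hl
  have h := (hl.mono hs.2).norm_walkSum_ind_sq_le hs.1 H x l.2 0
  simp only [add_zero] at h
  refine h.trans ?_
  have h1 : (jumpCount l.1 s : ℝ) ≤ jumpCount l.1 T := by exact_mod_cast hl.jumpCount_le hs.2
  have h2 := Real.rpow_le_rpow hs.1 hs.2 (by linarith [H.2.1] : 0 ≤ 2 * (H : ℝ))
  have h3 := hs.1
  gcongr

lemma ae_norm_walkSum_mollify_sq_le (hκ : 0 < κ) (hX : IsSimpleWalkData κ τ ξ Q)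
    (hs : s ∈ Icc 0 T) (H : HurstIndex) (x : Site d) {ε : ℝ} (hε : 0 < ε) :
    ∀ᵐ l ∂(pathLaw τ ξ Q), ‖walkSum (mollify ε (ind H)) x l.1 l.2 s‖ ^ 2 ≤
      (jumpCount l.1 T + 1) * T ^ (2 * (H : ℝ)) := by
  filter_upwards [ae_pathLaw_isGoodPath hκ hX T] with l hl
  refine ((hl.mono hs.2).norm_walkSum_mollify_sq_le hs.1 H x l.2 hε).trans ?_
  have h1 : (jumpCount l.1 s : ℝ) ≤ jumpCount l.1 T := by exact_mod_cast hl.jumpCount_le hs.2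
  have h2 := Real.rpow_le_rpow hs.1 hs.2 (by linarith [H.2.1] : 0 ≤ 2 * (H : ℝ))
  have h3 := hs.1
  gcongr

lemma ae_norm_walkSum_mollify_sub_le (hκ : 0 < κ) (hX : IsSimpleWalkData κ τ ξ Q)
    (hs : s ∈ Icc 0 T) (H : HurstIndex) (x : Site d) {ε : ℝ} (hε : 0 < ε) :
    ∀ᵐ l ∂(pathLaw τ ξ Q),
      ‖walkSum (mollify ε (ind H)) x l.1 l.2 s - walkSum (ind H) x l.1 l.2 s‖ ≤
      (jumpCount l.1 T + 1) * (2 * ε ^ (H : ℝ)) := by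
  filter_upwards [ae_pathLaw_isGoodPath hκ hX T] with l hl
  refine (norm_walkSum_sub_le (norm_mollify_ind_sub_le hε) x l.1 l.2 s).trans ?_
  have h1 : (jumpCount l.1 s : ℝ) ≤ jumpCount l.1 T := by exact_mod_cast hl.jumpCount_le hs.2
  gcongr

lemma integrable_fkPair_ind (hW : IsFBMField H W P) (hκ : 0 < κ) (hX : IsSimpleWalkData κ τ ξ Q)
    (hu₀ : ∀ y, |u₀ y| ≤ C) (hs : s ∈ Icc 0 T) (x : Site d) :
    Integrable (fun l => u₀ (walk x l.1 l.2 s) • expPair hW (walkSum (ind H) x l.1 l.2 s))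
      (pathLaw τ ξ Q) :=
  integrable_fkPair hκ hX hu₀ (hs.1.trans hs.2) (continuous_ind H) x
    (ae_norm_walkSum_ind_sq_le hκ hX hs H x)

lemma integrable_fkPair_mollify (hW : IsFBMField H W P) (hκ : 0 < κ)
    (hX : IsSimpleWalkData κ τ ξ Q) (hu₀ : ∀ y, |u₀ y| ≤ C) (hs : s ∈ Icc 0 T) (x : Site d)
    {ε : ℝ} (hε : 0 < ε) :
    Integrable (fun l => u₀ (walk x l.1 l.2 s) •
      expPair hW (walkSum (mollify ε (ind H)) x l.1 l.2 s)) (pathLaw τ ξ Q) :=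
  integrable_fkPair hκ hX hu₀ (hs.1.trans hs.2) (continuous_mollify (continuous_ind H) ε) x
    (ae_norm_walkSum_mollify_sq_le hκ hX hs H x hε)

lemma integrable_fkWeightSmoothed_and_fkSmoothed_ae_eq (hW : IsFBMField H W P) (hκ : 0 < κ)
    (hX : IsSimpleWalkData κ τ ξ Q) (hu₀ : ∀ y, |u₀ y| ≤ C) (hs : s ∈ Icc 0 T) (x : Site d)
    {ε : ℝ} (hε : 0 < ε) :
    (∀ᵐ ω ∂P, Integrable (fun ω' => fkWeightSmoothed u₀ (fun r y => W r y ω) ε x s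
      (fun n => τ n ω') (fun n => ξ n ω')) Q) ∧
    fkSmoothed u₀ W τ ξ Q ε s x =ᵐ[P] (fkPair hW u₀ τ ξ Q (mollify ε (ind H)) s x).1 := by
  obtain ⟨h1, h2⟩ := integrable_fkWeight_and_fk_ae_eq hX ((isNoiseField_ind hW).mollify hε)
    (integrable_fkPair_mollify hW hκ hX hu₀ hs x hε)
  refine ⟨h1.mono fun ω hω => hω.congr (ae_fkWeightSmoothed_eq hW hκ hX u₀ hs.1 x ε ω).symm, ?_⟩
  exact EventuallyEq.trans (ae_of_all _ fun ω =>
    integral_congr_ae (ae_fkWeightSmoothed_eq hW hκ hX u₀ hs.1 x ε ω)) h2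

/-- The rate of convergence of the Feynman--Kac fields and their derivatives. -/
lemma exists_norm_fkPair_sub_le (hW : IsFBMField H W P) (hκ : 0 < κ)
    (hX : IsSimpleWalkData κ τ ξ Q) (hu₀ : ∀ y, |u₀ y| ≤ C) (hT : 0 ≤ T) (x : Site d) :
    ∃ K : ℝ, ∀ ε > 0, ∀ s ∈ Icc 0 T,
      ‖fkPair hW u₀ τ ξ Q (mollify ε (ind H)) s x - fkPair hW u₀ τ ξ Q (ind H) s x‖ ≤
        K * ε ^ (H : ℝ) := by
  set D := T ^ (2 * (H : ℝ))
  have hC : 0 ≤ C := (abs_nonneg _).trans (hu₀ 0)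
  -- The integrand is `C · 2(N+1) · e^{3R+2}` with `R = (N+1)D` and `N + 1 ≤ e^N`. Counting jumps up
  -- to `T` rather than `s` makes the constant independent of `s`.
  refine ⟨∫ l, 2 * C * Real.exp ((1 + 3 * D) * jumpCount l.1 T + (3 * D + 2)) ∂(pathLaw τ ξ Q),
    fun ε hε s hs => ?_⟩
  rw [fkPair, fkPair, ← integral_sub (integrable_fkPair_mollify hW hκ hX hu₀ hs x hε)
    (integrable_fkPair_ind hW hκ hX hu₀ hs x), ← integral_mul_const]
  refine norm_integral_le_of_norm_le
    (((integrable_exp_jumpCount hκ hX hT _ _).const_mul _).mul_const _) ?_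
  filter_upwards [ae_norm_walkSum_mollify_sub_le hκ hX hs H x hε,
    ae_norm_walkSum_mollify_sq_le hκ hX hs H x hε, ae_norm_walkSum_ind_sq_le hκ hX hs H x]
    with l h1 h2 h3
  have h4 := norm_expPair_sub_le hW h2 h3
  have h5 := Real.add_one_le_exp (jumpCount l.1 T : ℝ)
  rw [← smul_sub, norm_smul, Real.norm_eq_abs]
  calc _ ≤ C * (Real.exp (jumpCount l.1 T) * (2 * ε ^ (H : ℝ)) *
        Real.exp (3 * ((jumpCount l.1 T + 1) * D) + 2)) := by
        refine mul_le_mul (hu₀ _) (h4.trans ?_) (norm_nonneg _) hC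
        gcongr
        exact h1.trans (by gcongr)
    _ = 2 * C * (Real.exp (jumpCount l.1 T) *
          Real.exp (3 * ((jumpCount l.1 T + 1) * D) + 2)) * ε ^ (H : ℝ) := by ring
    _ = _ := by
        rw [← Real.exp_add]
        ring_nf

end FeynmanKac

end FractionalPAM

end

/-! ### Assembly of existence, membership in `𝔻^{1,2}` and convergence. -/

open FractionalPAM
theorem mainTheorem3 {d : ℕ} [NeZero d] (H : HurstIndex)
    {Ω Ω' : Type*} [MeasurableSpace Ω] [MeasurableSpace Ω']
    (P : Measure Ω) [IsProbabilityMeasure P] (Q : Measure Ω') [IsProbabilityMeasure Q]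
    (W : ℝ → Site d → Ω → ℝ) (hW : IsFBMField H W P)
    (κ : ℝ) (hκ : 0 < κ) (τ : ℕ → Ω' → ℝ) (ξ : ℕ → Ω' → Site d) (hX : IsSimpleWalkData κ τ ξ Q)
    (u₀ : Site d → ℝ) (hu₀ : ∃ C, ∀ y, |u₀ y| ≤ C) (T : ℝ) (hT : 0 < T) (x : Site d) :
    -- the expectations over the walk that define `u` and `u_ε` exist
    (∀ s ∈ Set.Icc 0 T, ∀ᵐ ω ∂P, Integrable (fun ω' =>
      fkWeight u₀ (fun r y => W r y ω) x s (fun n => τ n ω') (fun n => ξ n ω')) Q) ∧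
    (∀ ε > 0, ∀ s ∈ Set.Icc 0 T, ∀ᵐ ω ∂P, Integrable (fun ω' =>
      fkWeightSmoothed u₀ (fun r y => W r y ω) ε x s (fun n => τ n ω') (fun n => ξ n ω')) Q) ∧
    -- `u` and `u_ε` are in `𝔻^{1,2}`
    (∀ s ∈ Set.Icc 0 T, MemD12 hW (fk u₀ W τ ξ Q s x)) ∧
    (∀ ε > 0, ∀ s ∈ Set.Icc 0 T, MemD12 hW (fkSmoothed u₀ W τ ξ Q ε s x)) ∧
    -- `u_ε - u` and its Malliavin derivative `D` tend to `0`, uniformly on `[0,T]`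
    ∃ D : ℝ → ℝ → Ω → NoiseSpace d H,
      (∀ ε > 0, ∀ s ∈ Set.Icc 0 T, HasMalliavinDeriv hW
        (fun ω => fkSmoothed u₀ W τ ξ Q ε s x ω - fk u₀ W τ ξ Q s x ω) (D ε s)) ∧
      Tendsto (fun ε => ⨆ s ∈ Set.Icc 0 T, ∫⁻ ω,
          (‖fkSmoothed u₀ W τ ξ Q ε s x ω - fk u₀ W τ ξ Q s x ω‖ₑ ^ 2 + ‖D ε s ω‖ₑ ^ 2) ∂P)
        (𝓝[>] 0) (𝓝 0) := by
  obtain ⟨C, hC⟩ := hu₀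
  have hi := fun s (hs : s ∈ Icc 0 T) => integrable_fkPair_ind hW hκ hX hC hs x
  have hiε := fun ε (hε : 0 < ε) s (hs : s ∈ Icc 0 T) =>
    integrable_fkPair_mollify hW hκ hX hC hs x hε
  have hu := fun s (hs : s ∈ Icc 0 T) =>
    integrable_fkWeight_and_fk_ae_eq hX (isNoiseField_ind hW) (hi s hs)
  have huε := fun ε (hε : 0 < ε) s (hs : s ∈ Icc 0 T) =>
    integrable_fkWeightSmoothed_and_fkSmoothed_ae_eq hW hκ hX hC hs x hε
  have hsub : ∀ ε > 0, ∀ s ∈ Icc 0 T,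
      (fun ω => fkSmoothed u₀ W τ ξ Q ε s x ω - fk u₀ W τ ξ Q s x ω) =ᵐ[P]
        (fkPair hW u₀ τ ξ Q (mollify ε (ind H)) s x - fkPair hW u₀ τ ξ Q (ind H) s x).1 := by
    intro ε hε s hs
    filter_upwards [(huε ε hε s hs).2, (hu s hs).2,
      Lp.coeFn_sub (fkPair hW u₀ τ ξ Q (mollify ε (ind H)) s x).1
        (fkPair hW u₀ τ ξ Q (ind H) s x).1] with ω h1 h2 h3
    rw [h1, h2, Prod.fst_sub, h3, Pi.sub_apply]
  refine ⟨fun s hs => (hu s hs).1, fun ε hε s hs => (huε ε hε s hs).1,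
    fun s hs => ⟨_, hasMalliavinDeriv_of_mem_closure hW (fkPair_mem_closure hX (hi s hs))
      (hu s hs).2⟩,
    fun ε hε s hs => ⟨_, hasMalliavinDeriv_of_mem_closure hW
      (fkPair_mem_closure hX (hiε ε hε s hs)) (huε ε hε s hs).2⟩,
    fun ε s => (fkPair hW u₀ τ ξ Q (mollify ε (ind H)) s x - fkPair hW u₀ τ ξ Q (ind H) s x).2,
    fun ε hε s hs => hasMalliavinDeriv_of_mem_closure hW (Submodule.sub_mem _
      (fkPair_mem_closure hX (hiε ε hε s hs)) (fkPair_mem_closure hX (hi s hs)))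
      (hsub ε hε s hs), ?_⟩
  obtain ⟨K, hK⟩ := exists_norm_fkPair_sub_le hW hκ hX hC hT.le x
  -- The factor `2` counts the field and its derivative, each bounded by the maximum norm of the
  -- pair.
  have hlim : Tendsto (fun ε : ℝ => 2 * ENNReal.ofReal (K * ε ^ (H : ℝ)) ^ 2) (𝓝[>] 0) (𝓝 0) := by
    have h1 : Continuous fun ε : ℝ => K * ε ^ (H : ℝ) :=
      continuous_const.mul (continuous_id.rpow_const fun _ => Or.inr H.2.1.le)
    have h2 := ENNReal.Tendsto.const_mul (a := 2) (((ENNReal.continuous_pow 2).tendsto _).comp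
      ((ENNReal.continuous_ofReal.comp h1).tendsto 0)) (Or.inr (by norm_num))
    simp only [Function.comp_apply, Real.zero_rpow H.2.1.ne', mul_zero, ENNReal.ofReal_zero, ne_eq,
      OfNat.ofNat_ne_zero, not_false_eq_true, zero_pow] at h2
    exact h2.mono_left nhdsWithin_le_nhds
  refine tendsto_of_tendsto_of_tendsto_of_le_of_le' tendsto_const_nhds hlim
    (Eventually.of_forall fun _ => zero_le) ?_
  filter_upwards [self_mem_nhdsWithin] with ε hε
  refine iSup₂_le fun s hs => ?_
  set p := fkPair hW u₀ τ ξ Q (mollify ε (ind H)) s x - fkPair hW u₀ τ ξ Q (ind H) s x with hp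
  rw [lintegral_add_right' _ ((Lp.aestronglyMeasurable p.2).enorm.pow_const 2),
    lintegral_enorm_sq_eq_of_ae_eq p.1 (hsub ε hε s hs),
    lintegral_enorm_sq_eq_of_ae_eq p.2 (EventuallyEq.refl _ _), two_mul]
  have hb := hK ε hε s hs
  rw [← hp] at hb
  have hb1 : ‖p.1‖ₑ ≤ ENNReal.ofReal (K * ε ^ (H : ℝ)) := by
    rw [← ofReal_norm]
    exact ENNReal.ofReal_le_ofReal ((norm_fst_le p).trans hb)
  have hb2 : ‖p.2‖ₑ ≤ ENNReal.ofReal (K * ε ^ (H : ℝ)) := by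
    rw [← ofReal_norm]
    exact ENNReal.ofReal_le_ofReal ((norm_snd_le p).trans hb)
  gcongr
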